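/- **Setting.** Identify $\mathbb C=\mathbb R^2$ with dot product $\langle\cdot,\cdot\rangle$, and $\mathbb R^4$ with the quaternions; $L_i,L_j$ are left multiplication by $i,j$, and $R_i,R_j,R_k$ right multiplication by $i,j,k$; $L_i$ is the complex structure. Let $\mathfrak g=\{(aL_i+b_1R_i+b_2R_j+b_3R_k,\,t)\}$ (all coefficients real, $t\in\mathbb R^4$) with bracket $[(\eta,t),(\eta',t')]=(\eta\eta'-\eta'\eta,\ \eta t'-\eta' t)$, and let $\tau(\eta,t)=(-L_j\eta L_j,\,-L_jt)$, an automorphism of order four of $\mathfrak g\otimes\mathbb C$; a subscript $k\in\{-1,0,1,2\}$ on a form denotes its component in the eigenspace of $\tau$ for $i^k$. A polynomial loop $\xi_\lambda=\sum_{n=-d}^d\lambda^n\hat\xi_n$ is *real and twisted* if $\xi_\lambda\in\mathfrak g$ and $\xi_{i\lambda}=\tau(\xi_\lambda)$ for all $|\lambda|=1$. Let $X:\mathbb C\to\mathbb R^4$ be a smooth conformal Lagrangian immersion. A function $\beta$ is a Lagrangian angle of $X$ if $(dx^1+i\,dx^2)\wedge(dx^3+i\,dx^4)(X_x,X_y)=|X_x|^2e^{i\beta}$;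 $X$ is Hamiltonian stationary if it has a harmonic Lagrangian angle. Let $\alpha=U^{-1}dU$ be the Maurer–Cartan form of the spinor lift $U=(e^{\beta L_i/2},X)$, put $u=e^{-\beta L_i/2}\,\partial X/\partial z$, and $$\alpha_\lambda=\lambda^{-2}\alpha_2'+\lambda^{-1}\alpha_{-1}'+\alpha_0+\lambda\alpha_1''+\lambda^2\alpha_2''$$ ($'$ and $''$ are the $dz$ and $d\bar z$ parts). For $d\in4\mathbb N+2$, a Hamiltonian stationary $X$ with Lagrangian angle $\beta$ is a *finite type solution of type $d$* if there is a smooth map $z\mapsto\xi_\lambda(z)$ into the real twisted polynomial loops of degree $d$, without terms of exponent $\equiv0\pmod 4$, such that $d\xi_\lambda=[\xi_\lambda,\alpha_\lambda]$ for all $|\lambda|=1$ and $\alpha(\partial/\partial z)=\hat\xi_{-d}+\hat\xi_{-d+1}$. Let $\Gamma\subset\mathbb C$ be a lattice, $\Gamma^*$ its dual lattice with respect to $\langle\cdot,\cdot\rangle$, and for $\beta_0\in\mathbb C$ $$\Gamma^*_{\beta_0}=\Big\{\gamma\in\tfrac{\beta_0}2+\Gamma^*\ :\ |\gamma|^2=\big|\tfrac{\beta_0}2\big|^2,\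 \gamma^2\neq\big(\tfrac{\beta_0}2\big)^2\Big\}.$$ **Theorem.** Let $d=4p+2$ with $p\in\mathbb N$, and let $X$ be a $\Gamma$-periodic finite type solution of type $d$, with Lagrangian angle $\beta=2\pi\langle\beta_0,z\rangle+\text{const}$ and map $\xi_\lambda$ as above. The Fourier frequencies of $X$ are those $\gamma\in\frac12\Gamma^*$ for which the Fourier coefficient $\hat u_\gamma$ of the $2\Gamma$-periodic map $u$, with respect to $e^{2i\pi\langle\gamma,z\rangle}$, is not zero. Fix $z_0\in\mathbb C$, let $\eta_\lambda=\xi_\lambda(z_0)$ be the initial value (the constant potential), and define $c_q$ for $-p-1\le q\le p-1$ by letting $\frac{\pi\bar\beta_0c_q}{2}$ be the coefficient of $L_i$ in $\hat\eta_{4q+2}$. Then: 1. every Fourier frequency lies in $\Gamma^*_{\beta_0}$; 2. every Fourier frequency $\gamma$ is a root of the following polynomial, which has degree exactly $d$ and depends only on $\beta_0$ and $\eta_\lambda$: $$\gamma^{4p+2}+\frac{\bar\beta_0}{2}\Big(\frac{\beta_0}{2}\Big)^{4p+1}\sum_{q=0}^{2p}c_{q-p-1}\Big(\frac{2\gamma}{\beta_0}\Big)^{2q}=0;$$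 3. consequently there are at most $d$ Fourier frequencies; in particular $\mathrm{Card}(\Gamma^*_{\beta_0})\le d$ as soon as every element of $\Gamma^*_{\beta_0}$ occurs as a Fourier frequency. -/

import Mathlib

open scoped Matrix ContDiff

noncomputable section

namespace HSL

/-! ### Euclidean symplectic 4-space and its complexified symmetry Lie algebra -/

/-- Left multiplication by the quaternion `i` on `ℝ⁴`; it is the complex structure `J`. -/
def Li : Matrix (Fin 4) (Fin 4) ℝ := !![0, -1, 0, 0; 1, 0, 0, 0; 0, 0, 0, -1; 0, 0, 1, 0]

/-- Left multiplication by the quaternion `j`. -/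
def Lj : Matrix (Fin 4) (Fin 4) ℝ := !![0, 0, -1, 0; 0, 0, 0, 1; 1, 0, 0, 0; 0, -1, 0, 0]

/-- Right multiplication by the quaternion `i`. -/
def Ri : Matrix (Fin 4) (Fin 4) ℝ := !![0, -1, 0, 0; 1, 0, 0, 0; 0, 0, 0, 1; 0, 0, -1, 0]

/-- Right multiplication by the quaternion `j`. -/
def Rj : Matrix (Fin 4) (Fin 4) ℝ := !![0, 0, -1, 0; 0, 0, 0, -1; 1, 0, 0, 0; 0, 1, 0, 0]

/-- Right multiplication by the quaternion `k`. -/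
def Rk : Matrix (Fin 4) (Fin 4) ℝ := !![0, 0, 0, -1; 0, 0, 1, 0; 0, -1, 0, 0; 1, 0, 0, 0]

/-- A real matrix seen as a complex one. -/
def cplx (A : Matrix (Fin 4) (Fin 4) ℝ) : Matrix (Fin 4) (Fin 4) ℂ := A.map (fun x => (x : ℂ))

/-- Ambient space `gl(4, ℂ) ⊕ ℂ⁴` of the complexified Lie algebra `𝔤 ⊗ ℂ` : pairs
(rotation part, translation part). -/
abbrev GC := Matrix (Fin 4) (Fin 4) ℂ × (Fin 4 → ℂ)

/-- The Lie algebra `𝔤 = {(a L_i + b₁ R_i + b₂ R_j + b₃ R_k, t)}`, all coefficients real, of the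
group of affine isometries of `ℝ⁴` which preserve the symplectic form. -/
def realAlg : Set GC :=
  {x | ∃ (a b₁ b₂ b₃ : ℝ) (t : Fin 4 → ℝ),
    x = (cplx (a • Li + b₁ • Ri + b₂ • Rj + b₃ • Rk), fun i => (t i : ℂ))}

/-- The Lie bracket `[(η, t), (η', t')] = (η η' - η' η, η t' - η' t)`. -/
def bracket (x y : GC) : GC := (x.1 * y.1 - y.1 * x.1, x.1 *ᵥ y.2 - y.1 *ᵥ x.2)

/-- The order four automorphism `τ (η, t) = (-L_j η L_j, -L_j t)`: conjugation by `(-L_j, 0)`. -/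
def tau (x : GC) : GC := (-(cplx Lj * x.1 * cplx Lj), -(cplx Lj *ᵥ x.2))

/-- The projection `[·]_k` onto the eigenspace of `τ` for the eigenvalue `i ^ k`. -/
def eigenProj (k : ℤ) (x : GC) : GC :=
  (1 / 4 : ℂ) • ∑ m ∈ Finset.range 4, Complex.I ^ (-(k * (m : ℤ))) • tau^[m] x

/-! ### Conformal Lagrangian immersions and the Lagrangian angle -/

/-- Smooth conformal Lagrangian immersions of the plane, `z = x + i y`; the symplectic form is
`ω(v, w) = ⟨J v, w⟩ = (dx¹ ∧ dx² + dx³ ∧ dx⁴)(v, w)`. -/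
structure IsConformalLagrangianImmersion (X : ℂ → Fin 4 → ℝ) : Prop where
  smooth : ContDiff ℝ ∞ X
  immersion : ∀ z, fderiv ℝ X z 1 ≠ 0
  same_length : ∀ z, fderiv ℝ X z 1 ⬝ᵥ fderiv ℝ X z 1
    = fderiv ℝ X z Complex.I ⬝ᵥ fderiv ℝ X z Complex.I
  orthogonal : ∀ z, fderiv ℝ X z 1 ⬝ᵥ fderiv ℝ X z Complex.I = 0
  lagrangian : ∀ z, (Li *ᵥ fderiv ℝ X z 1) ⬝ᵥ fderiv ℝ X z Complex.I = 0

/-- The complex volume form `(dx¹ + i dx²) ∧ (dx³ + i dx⁴)`. -/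
def complexVolume (v w : Fin 4 → ℝ) : ℂ :=
  ((v 0 : ℂ) + Complex.I * v 1) * ((w 2 : ℂ) + Complex.I * w 3)
    - ((w 0 : ℂ) + Complex.I * w 1) * ((v 2 : ℂ) + Complex.I * v 3)

/-- `β` is a real lift of the Lagrangian angle of the conformal Lagrangian immersion `X`: the value
of the complex volume form on the orthonormal frame `(X_x / |X_x|, X_y / |X_y|)` is
`e ^ (i β)` (and `|X_x| = |X_y|`). -/
def IsLagrangianAngle (X : ℂ → Fin 4 → ℝ) (β : ℂ → ℝ) : Prop :=
  ∀ z, complexVolume (fderiv ℝ X z 1) (fderiv ℝ X z Complex.I)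
    = ((fderiv ℝ X z 1 ⬝ᵥ fderiv ℝ X z 1 : ℝ) : ℂ) * Complex.exp (Complex.I * (β z : ℂ))

/-- A conformal Lagrangian immersion is Hamiltonian stationary when its Lagrangian angle is
harmonic. -/
def IsHamiltonianStationary (X : ℂ → Fin 4 → ℝ) : Prop :=
  ∃ β : ℂ → ℝ, InnerProductSpace.HarmonicOnNhd β Set.univ ∧ IsLagrangianAngle X β

/-! ### The spinor lift, its Maurer-Cartan form and the extended form -/

/-- The rotation part `e ^ (β L_i / 2)` of the spinor lift (recall `L_i ^ 2 = -1`). -/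
def spinor (β : ℂ → ℝ) (z : ℂ) : Matrix (Fin 4) (Fin 4) ℝ :=
  Real.cos (β z / 2) • (1 : Matrix (Fin 4) (Fin 4) ℝ) + Real.sin (β z / 2) • Li

/-- The Maurer-Cartan form `U⁻¹ dU = (F⁻¹ dF, F⁻¹ dX)` of the lift `U = (F, X)`, at the point `z`
and on the real tangent vector `v`. -/
def maurerCartan (F : ℂ → Matrix (Fin 4) (Fin 4) ℝ) (X : ℂ → Fin 4 → ℝ) (z v : ℂ) : GC :=
  (cplx ((F z)⁻¹ * Matrix.of (fun i j => fderiv ℝ (fun w => F w i j) z v)),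
    fun i => ((((F z)⁻¹ *ᵥ fderiv ℝ X z v) i : ℝ) : ℂ))

/-- The value `α(∂/∂z)` of a 1-form. -/
def formDz (α : ℂ → ℂ → GC) (z : ℂ) : GC := (1 / 2 : ℂ) • (α z 1 - Complex.I • α z Complex.I)

/-- The value `α(∂/∂z̄)` of a 1-form. -/
def formDzbar (α : ℂ → ℂ → GC) (z : ℂ) : GC := (1 / 2 : ℂ) • (α z 1 + Complex.I • α z Complex.I)

/-- The extended form
`α_λ = λ⁻² α₂' + λ⁻¹ α₋₁' + α₀ + λ α₁'' + λ² α₂''`, where `α_k` is the component of `α` in the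
eigenspace of `τ` for `i ^ k`, and `'`, `''` denote the `dz` and `dz̄` parts. -/
def extendedForm (α : ℂ → ℂ → GC) (lam z v : ℂ) : GC :=
  lam ^ (-2 : ℤ) • v • eigenProj 2 (formDz α z)
    + lam ^ (-1 : ℤ) • v • eigenProj (-1) (formDz α z)
    + eigenProj 0 (α z v)
    + lam • (starRingEnd ℂ v) • eigenProj 1 (formDzbar α z)
    + lam ^ 2 • (starRingEnd ℂ v) • eigenProj 2 (formDzbar α z)

/-- The vector `u = e ^ (-β L_i / 2) ∂X/∂z`, i.e. the translation part of `α(∂/∂z)` for the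
spinor lift. -/
def uVec (X : ℂ → Fin 4 → ℝ) (β : ℂ → ℝ) (z : ℂ) : Fin 4 → ℂ :=
  (formDz (maurerCartan (spinor β) X) z).2

/-! ### Polynomial loops and finite type solutions -/

/-- The loop `λ ↦ ∑_{n = -d}^{d} λ ^ n c_n` with Fourier coefficients `c_n`. -/
def loopEval (d : ℕ) (c : ℤ → GC) (lam : ℂ) : GC :=
  ∑ n ∈ Finset.Icc (-(d : ℤ)) (d : ℤ), lam ^ n • c n

/-- The sequence `c` of Fourier coefficients defines an element of the space of real twisted
polynomial loops of degree `d`. -/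
structure IsRealTwistedLoop (d : ℕ) (c : ℤ → GC) : Prop where
  degree : ∀ n : ℤ, (d : ℤ) < |n| → c n = 0
  real : ∀ lam : ℂ, ‖lam‖ = 1 → loopEval d c lam ∈ realAlg
  twisted : ∀ lam : ℂ, ‖lam‖ = 1 → loopEval d c (Complex.I * lam) = tau (loopEval d c lam)

/-- Directional derivative, taken entry by entry, of a map into `GC`. -/
def dGC (f : ℂ → GC) (z v : ℂ) : GC :=
  (Matrix.of (fun i j => fderiv ℝ (fun w => (f w).1 i j) z v),
    fun i => fderiv ℝ (fun w => (f w).2 i) z v)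

/-- `X`, with Lagrangian angle `β`, is a finite type solution of type `d`, with the polynomial
Killing field `ξ_λ(z) = ∑_{n = -d}^{d} λ ^ n ξ_n(z)`: a smooth map into the real twisted polynomial
loops of degree `d`, without terms of exponent `0 mod 4`, which satisfies the Lax equation
`dξ_λ = [ξ_λ, α_λ]` for the extended form of the spinor lift of `X`, and which is adapted, i.e.
`α(∂/∂z) = ξ_{-d} + ξ_{-d+1}` (for `d ∈ 4ℕ + 2` the further term coming from `ξ_{-d+2}` is
absent, as `-d + 2` is `0 mod 4`). -/
structure IsFiniteTypeSolution (d : ℕ) (X : ℂ → Fin 4 → ℝ) (β : ℂ → ℝ) (ξ : ℤ → ℂ → GC) :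
    Prop where
  immersion : IsConformalLagrangianImmersion X
  stationary : IsHamiltonianStationary X
  angle : IsLagrangianAngle X β
  smooth_rot : ∀ n i j, ContDiff ℝ ∞ (fun z => (ξ n z).1 i j)
  smooth_trans : ∀ n i, ContDiff ℝ ∞ (fun z => (ξ n z).2 i)
  loop : ∀ z, IsRealTwistedLoop d (fun n => ξ n z)
  normalized : ∀ n : ℤ, (4 : ℤ) ∣ n → ∀ z, ξ n z = 0
  lax : ∀ lam : ℂ, ‖lam‖ = 1 → ∀ z v : ℂ,
    dGC (fun w => loopEval d (fun n => ξ n w) lam) z v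
      = bracket (loopEval d (fun n => ξ n z) lam)
          (extendedForm (maurerCartan (spinor β) X) lam z v)
  adapted : ∀ z, formDz (maurerCartan (spinor β) X) z = ξ (-(d : ℤ)) z + ξ (-(d : ℤ) + 1) z

/-! ### Lattices and Fourier frequencies -/

/-- The lattice `Γ = ℤ b₀ ⊕ ℤ b₁`. -/
def lattice (b : Module.Basis (Fin 2) ℝ ℂ) : Submodule ℤ ℂ := Submodule.span ℤ (Set.range b)

/-- The dual lattice `Γ*`, for the usual dot product of `ℂ = ℝ²`. -/
def dualLattice (b : Module.Basis (Fin 2) ℝ ℂ) : Set ℂ :=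
  {γ | ∀ g ∈ lattice b, ∃ n : ℤ, inner ℝ γ g = (n : ℝ)}

/-- The set `Γ*_{β₀}` of all `γ ∈ β₀/2 + Γ*` with `|γ| = |β₀/2|` and `γ² ≠ (β₀/2)²`. -/
def dualCircle (b : Module.Basis (Fin 2) ℝ ℂ) (β₀ : ℂ) : Set ℂ :=
  {γ | γ - β₀ / 2 ∈ dualLattice b ∧ ‖γ‖ ^ 2 = ‖β₀ / 2‖ ^ 2 ∧ γ ^ 2 ≠ (β₀ / 2) ^ 2}

/-- The Fourier coefficient at `γ ∈ Γ*/2` of a `2Γ`-periodic map: the mean value of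
`e ^ (-2 i π ⟨γ, z⟩) u(z)` over the period parallelogram of `2Γ`. -/
def fourierCoefficient (b : Module.Basis (Fin 2) ℝ ℂ) (u : ℂ → Fin 4 → ℂ) (γ : ℂ) : Fin 4 → ℂ :=
  fun i => ∫ s in (0 : ℝ)..1, ∫ t in (0 : ℝ)..1,
    Complex.exp (-2 * Complex.I * Real.pi
        * ((inner ℝ γ (2 * (s • b 0 + t • b 1)) : ℝ) : ℂ))
      * u (2 * (s • b 0 + t • b 1)) i

/-- The Fourier frequencies of a `2Γ`-periodic map: all `γ ∈ Γ*/2` with a non-zero Fourier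
coefficient. -/
def frequencies (b : Module.Basis (Fin 2) ℝ ℂ) (u : ℂ → Fin 4 → ℂ) : Set ℂ :=
  {γ | 2 * γ ∈ dualLattice b ∧ fourierCoefficient b u γ ≠ 0}

/-- The affine function `2π⟨β₀, z⟩ + θ`. -/
def affineAngle (β₀ : ℂ) (θ : ℝ) (z : ℂ) : ℝ := 2 * Real.pi * inner ℝ β₀ z + θ

/-! ### The polynomial -/

/-- The coefficient of `L_i` in the rotation part of an element of `𝔤 ⊗ ℂ`. -/
def liCoeff (x : GC) : ℂ := -(1 / 4) * (cplx Li * x.1).trace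

/-- The number `c_q` such that the coefficient of exponent `4q + 2` of the loop `η` is
`(π β̄₀ c_q / 2) (L_i, 0)`. -/
def potentialCoeff (β₀ : ℂ) (η : ℤ → GC) (q : ℤ) : ℂ :=
  2 / (Real.pi * starRingEnd ℂ β₀) * liCoeff (η (4 * q + 2))

/-- The polynomial
`γ^{4p+2} + (β̄₀/2) (β₀/2)^{4p+1} ∑_{q=0}^{2p} c_{q-p-1} (2γ/β₀)^{2q}` in the unknown `γ`, built
from `β₀` and the constant potential `η` (given by its Fourier coefficients). -/
def frequencyPolynomial (p : ℕ) (β₀ : ℂ) (η : ℤ → GC) : Polynomial ℂ :=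
  Polynomial.X ^ (4 * p + 2)
    + Polynomial.C (starRingEnd ℂ β₀ / 2 * (β₀ / 2) ^ (4 * p + 1))
      * ∑ q ∈ Finset.range (2 * p + 1),
          Polynomial.C (potentialCoeff β₀ η ((q : ℤ) - p - 1))
            * (Polynomial.C (2 / β₀) * Polynomial.X) ^ (2 * q)

end HSL

end

noncomputable section

namespace HSL

/-! ### Laurent polynomials on the unit circle -/

/-! The engine is the coefficientwise form of the Lax equation. Reality, twisting and the absence of
exponents divisible by 4 force every rotation coefficient to be `w_n • L_i`, with `w_n = 0` unless
`n ≡ 2 mod 4` (`IsRealTwistedLoop.rot_eq`). For an affine angle the rotation part of `α_λ` is a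
multiple of `L_i` too, so everything commutes and each `w_n` is constant (`rot_const`). The `dz`
part of the translation equation expresses the coefficient `t_{n+2}` through `w_{n+1} u` and `L_i
∂t_n` (`trans_add_two`); the recursion starts at `t_{-d+1} = u` and must end at `t_{d+1} = 0`.

On Fourier coefficients at `γ`, `∂` is multiplication by `iπγ̄`, and two steps of the recursion
multiply `t̂_n` by `(2γ̄/β̄₀)²` and add a multiple of `û`. Once `|γ| = |β₀/2|` is known, this factor
is `(2γ/β₀)⁻²`, so clearing denominators telescopes the recursion into a power sum in `(2γ/β₀)²`
(`pow_smul_fourierCoefficient`). At the last step it reads `P(γ) û = 0`, and `û ≠ 0` gives the root.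
The leading coefficient is known because reality yields `w_d = conj w_{-d} = πβ₀/2`.

The circle `Γ*_{β₀}` comes from three facts. The spinor changes by a sign under a period of `Γ`,
which places `γ` in `β₀/2 + Γ*`. The equations `∂̄u = (πβ̄₀/2) L_i ū` and `∂ū = (πβ₀/2) L_i u` fix
`|γ|` (`norm_sq_eq`). At `γ = ±β₀/2` one eigencomponent of `û` for `L_i` is the mean of a derivative
of a periodic map, hence zero; the other is killed because `L_i` and `L_j` anticommute
(`fourierCoefficient_eq_zero_of_eq_half`). -/

/-- On the unit circle, `f` is the Laurent polynomial with coefficients `c`. -/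
def HasLaurent (f : ℂ → ℂ) (c : ℤ → ℂ) : Prop :=
  (Function.support c).Finite ∧ ∀ lam : ℂ, ‖lam‖ = 1 → f lam = ∑ᶠ n : ℤ, lam ^ n * c n

theorem finite_support_mul {c : ℤ → ℂ} (hc : (Function.support c).Finite) (lam : ℂ) :
    (Function.support fun n : ℤ => lam ^ n * c n).Finite :=
  hc.subset fun n hn h => hn (by simp [h])

namespace HasLaurent

variable {f g : ℂ → ℂ} {c e : ℤ → ℂ}

theorem add (hf : HasLaurent f c) (hg : HasLaurent g e) :
    HasLaurent (fun l => f l + g l) (fun n => c n + e n) := by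
  refine ⟨(hf.1.union hg.1).subset (Function.support_add c e), fun l hl => ?_⟩
  beta_reduce
  rw [hf.2 l hl, hg.2 l hl,
    ← finsum_add_distrib (finite_support_mul hf.1 l) (finite_support_mul hg.1 l)]
  simp only [mul_add]

theorem const_mul (hf : HasLaurent f c) (a : ℂ) :
    HasLaurent (fun l => a * f l) (fun n => a * c n) := by
  refine ⟨hf.1.subset fun n hn h => hn (by simp [h]), fun l hl => ?_⟩
  beta_reduce
  rw [hf.2 l hl, mul_finsum]
  exact finsum_congr fun n => by ring

theorem sub (hf : HasLaurent f c) (hg : HasLaurent g e) :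
    HasLaurent (fun l => f l - g l) (fun n => c n - e n) := by
  simpa [sub_eq_add_neg] using hf.add (hg.const_mul (-1))

/-- Sums over all of `ℤ` with finite support make this a plain reindexing: no window of exponents
has to be enlarged. -/
theorem zpow_mul (hf : HasLaurent f c) (k : ℤ) :
    HasLaurent (fun l => l ^ k * f l) (fun n => c (n - k)) := by
  refine ⟨hf.1.preimage (f := fun n => n - k) (sub_left_injective.injOn), fun l hl => ?_⟩
  have hl0 : l ≠ 0 := by rintro rfl; simp at hl
  beta_reduce
  rw [hf.2 l hl, mul_finsum, ← finsum_comp_equiv (Equiv.subRight k)]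
  refine finsum_congr fun n => ?_
  simp only [Equiv.subRight_apply]
  rw [← mul_assoc, ← zpow_add₀ hl0]
  congr 2
  ring

/-- On the unit circle `λ̄ = λ⁻¹`, so conjugation reverses the exponents. -/
theorem conj (hf : HasLaurent f c) :
    HasLaurent (fun l => starRingEnd ℂ (f l)) (fun n => starRingEnd ℂ (c (-n))) := by
  refine ⟨(hf.1.preimage (f := fun n => -n) neg_injective.injOn).subset
    fun n hn => by simpa using hn, fun l hl => ?_⟩
  have hl0 : l ≠ 0 := by rintro rfl; simp at hl
  have hinv : starRingEnd ℂ l = l⁻¹ := by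
    rw [Complex.inv_def, Complex.normSq_eq_norm_sq, hl]; simp
  beta_reduce
  rw [hf.2 l hl, ← finsum_comp_equiv (Equiv.neg ℤ)]
  have := (starRingEnd ℂ).toAddMonoidHom.map_finsum
    (f := fun n : ℤ => l ^ (-n) * c (-n))
    ((finite_support_mul hf.1 l).preimage (f := fun n => -n) neg_injective.injOn)
  simp only [RingHom.toAddMonoidHom_eq_coe, AddMonoidHom.coe_coe] at this
  simp only [Equiv.neg_apply]
  rw [this]
  refine finsum_congr fun n => ?_
  rw [map_mul, map_zpow₀, hinv, inv_zpow', neg_neg]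

/-- The powers of `λ` are distinct characters of the circle group, hence linearly independent by
Dedekind. This is what turns identities assumed only for `|λ| = 1` into identities of coefficients.
-/
theorem eq_zero (hf : HasLaurent f c) (h0 : ∀ l : ℂ, ‖l‖ = 1 → f l = 0) (n : ℤ) : c n = 0 := by
  let φ : ℤ → (Circle →* ℂ) := fun n =>
    { toFun := fun x => (x : ℂ) ^ n
      map_one' := by simp
      map_mul' := fun x y => by rw [Circle.coe_mul, mul_zpow] }
  have hφ : Function.Injective φ := by
    intro n m hnm
    by_contra hne
    have hd : ((n : ℂ) - m) ≠ 0 := by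
      rw [sub_ne_zero]; exact_mod_cast hne
    -- At `e^{iπ/(n-m)}` the quotient of the two characters is `e^{iπ} = -1`.
    have h1 := DFunLike.congr_fun hnm (Circle.exp (Real.pi / ((n : ℝ) - m)))
    simp only [φ, MonoidHom.coe_mk, OneHom.coe_mk, Circle.coe_exp] at h1
    have h2 : Complex.exp (((Real.pi / ((n : ℝ) - m) : ℝ) : ℂ) * Complex.I) ^ (n - m) = 1 := by
      rw [zpow_sub₀ (Complex.exp_ne_zero _), h1, div_self]
      exact zpow_ne_zero _ (Complex.exp_ne_zero _)
    rw [← Complex.exp_int_mul] at h2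
    have h3 : ((n - m : ℤ) : ℂ) * (((Real.pi / ((n : ℝ) - m) : ℝ) : ℂ) * Complex.I)
        = Real.pi * Complex.I := by
      push_cast; field_simp
    rw [h3, Complex.exp_pi_mul_I] at h2
    norm_num at h2
  have hli := (linearIndependent_monoidHom Circle ℂ).comp φ hφ
  rw [linearIndependent_iff'] at hli
  by_cases hn : n ∈ hf.1.toFinset
  · refine hli hf.1.toFinset c ?_ n hn
    ext x
    have hx := hf.2 x x.norm_coe
    rw [h0 x x.norm_coe, finsum_eq_sum_of_support_subset (s := hf.1.toFinset) _
      (fun k hk => by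
        simp only [Set.Finite.coe_toFinset, Function.mem_support]
        intro h; exact hk (by simp [h]))] at hx
    rw [Finset.sum_apply, Pi.zero_apply, hx]
    refine Finset.sum_congr rfl fun k _ => ?_
    simp [φ, mul_comm]
  · simpa using hn

theorem unique (hf : HasLaurent f c) (hg : HasLaurent g e)
    (h : ∀ l : ℂ, ‖l‖ = 1 → f l = g l) (n : ℤ) : c n = e n :=
  sub_eq_zero.1 ((hf.sub hg).eq_zero (fun l hl => by simp [h l hl]) n)

end HasLaurent

theorem hasLaurent_sum {d : ℕ} {c : ℤ → ℂ} (hc : ∀ n : ℤ, (d : ℤ) < |n| → c n = 0) :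
    HasLaurent (fun l => ∑ n ∈ Finset.Icc (-(d : ℤ)) (d : ℤ), l ^ n * c n) c := by
  have hs : Function.support c ⊆ Finset.Icc (-(d : ℤ)) (d : ℤ) := fun n hn => by
    by_contra h
    refine hn (hc n (lt_of_not_ge fun h' => h ?_))
    simpa [abs_le] using h'
  refine ⟨(Finset.finite_toSet _).subset hs, fun l _ => ?_⟩
  rw [finsum_eq_sum_of_support_subset]
  exact fun n hn => hs fun h => hn (by simp [h])

/-! ### Means over the period parallelogram -/

/-- The mean value over the period parallelogram of `2Γ`. -/
def torusMean (b : Module.Basis (Fin 2) ℝ ℂ) (h : ℂ → ℂ) : ℂ :=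
  ∫ s in (0 : ℝ)..1, ∫ t in (0 : ℝ)..1, h (2 * (s • b 0 + t • b 1))

/-- Periodicity with respect to `2Γ`. -/
def DoublyPeriodic (b : Module.Basis (Fin 2) ℝ ℂ) (h : ℂ → ℂ) : Prop :=
  ∀ i z, h (z + 2 * b i) = h z

variable {b : Module.Basis (Fin 2) ℝ ℂ} {f g h : ℂ → ℂ}

theorem continuous_comp_parallelogram (hh : Continuous h) :
    Continuous (Function.uncurry fun s t : ℝ => h (2 * (s • b 0 + t • b 1))) := by
  unfold Function.uncurry
  fun_prop

theorem continuous_inner_integral (hh : Continuous h) :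
    Continuous fun s : ℝ => ∫ t in (0 : ℝ)..1, h (2 * (s • b 0 + t • b 1)) :=
  intervalIntegral.continuous_parametric_intervalIntegral_of_continuous'
    (continuous_comp_parallelogram hh) 0 1

theorem torusMean_add (hf : Continuous f) (hg : Continuous g) :
    torusMean b (fun z => f z + g z) = torusMean b f + torusMean b g := by
  unfold torusMean
  rw [← intervalIntegral.integral_add ((continuous_inner_integral hf).intervalIntegrable _ _)
    ((continuous_inner_integral hg).intervalIntegrable _ _)]
  refine intervalIntegral.integral_congr fun s _ => ?_
  simp only
  rw [← intervalIntegral.integral_add]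
  all_goals exact Continuous.intervalIntegrable (by fun_prop) _ _

theorem torusMean_const_mul (a : ℂ) (f : ℂ → ℂ) :
    torusMean b (fun z => a * f z) = a * torusMean b f := by
  simp only [torusMean, intervalIntegral.integral_const_mul]

theorem integral_add_half_of_periodic {k : ℝ → ℂ} (hk : Function.Periodic k 1) :
    ∫ t in (0 : ℝ)..1, k (t + 1 / 2) = ∫ t in (0 : ℝ)..1, k t := by
  rw [intervalIntegral.integral_comp_add_right k (1 / 2), zero_add, add_comm (1 : ℝ),
    hk.intervalIntegral_add_eq (1 / 2) 0, zero_add]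

/-- The parallelogram is that of `2Γ`, so a translation by `b i` is half a period in the
corresponding unit parameter. -/
theorem torusMean_add_basis (hp : DoublyPeriodic b h) (i : Fin 2) :
    torusMean b (fun z => h (z + b i)) = torusMean b h := by
  unfold torusMean
  fin_cases i
  · have hper : Function.Periodic
        (fun s : ℝ => ∫ t in (0 : ℝ)..1, h (2 * (s • b 0 + t • b 1))) 1 := by
      intro s
      refine intervalIntegral.integral_congr fun t _ => ?_
      rw [← hp 0 (2 * (s • b 0 + t • b 1))]
      congr 1
      simp only [Complex.real_smul]; push_cast; ring
    rw [← integral_add_half_of_periodic hper]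
    refine intervalIntegral.integral_congr fun s _ => ?_
    refine intervalIntegral.integral_congr fun t _ => ?_
    simp only [Complex.real_smul, Fin.zero_eta]
    congr 1
    push_cast; ring
  · refine intervalIntegral.integral_congr fun s _ => ?_
    have hper : Function.Periodic (fun t : ℝ => h (2 * (s • b 0 + t • b 1))) 1 := by
      intro t
      beta_reduce
      rw [← hp 1 (2 * (s • b 0 + t • b 1))]
      congr 1
      simp only [Complex.real_smul]; push_cast; ring
    beta_reduce
    rw [← integral_add_half_of_periodic hper]
    refine intervalIntegral.integral_congr fun t _ => ?_
    simp only [Complex.real_smul, Fin.mk_one]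
    congr 1
    push_cast; ring

theorem hasDerivAt_comp_line (hh : ContDiff ℝ 1 h) (w v : ℂ) (t : ℝ) :
    HasDerivAt (fun t : ℝ => h (w + (t : ℂ) * v)) (fderiv ℝ h (w + t * v) v) t := by
  have h1 : HasDerivAt (fun t : ℝ => w + (t : ℂ) * v) v t := by
    simpa using ((Complex.ofRealCLM.hasDerivAt (x := t)).mul_const v).const_add w
  exact ((hh.differentiable one_ne_zero _).hasFDerivAt).comp_hasDerivAt t h1

theorem integral_fderiv_line (hh : ContDiff ℝ 1 h) {w v : ℂ} (hp : h (w + v) = h w) :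
    ∫ t in (0 : ℝ)..1, fderiv ℝ h (w + t * v) v = 0 := by
  rw [intervalIntegral.integral_eq_sub_of_hasDerivAt
    (fun t _ => hasDerivAt_comp_line hh w v t)]
  · simp [hp]
  · have := hh.continuous_fderiv one_ne_zero
    exact Continuous.intervalIntegrable (by fun_prop) _ _

/-- Along a period direction the derivative integrates to zero on each segment; any other direction
is a real combination of the two periods. -/
theorem torusMean_fderiv (hh : ContDiff ℝ 1 h) (hp : DoublyPeriodic b h) (v : ℂ) :
    torusMean b (fun z => fderiv ℝ h z v) = 0 := by
  have hc := hh.continuous_fderiv one_ne_zero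
  have key : ∀ i, torusMean b (fun z => fderiv ℝ h z (2 * b i)) = 0 := by
    refine Fin.forall_fin_two.2 ⟨?_, ?_⟩
    · unfold torusMean
      -- The variable `s` along `b 0` is the outer one, so Fubini is needed to integrate it first.
      rw [MeasureTheory.intervalIntegral_intervalIntegral_swap
        (((continuous_comp_parallelogram (b := b) (h := fun z => fderiv ℝ h z (2 * b 0))
          (by fun_prop)).continuousOn.integrableOn_compact
            (isCompact_uIcc.prod isCompact_uIcc)).mono_set
          (Set.prod_mono Set.uIoc_subset_uIcc Set.uIoc_subset_uIcc))]
      refine intervalIntegral.integral_zero_ae (.of_forall fun t _ => ?_)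
      rw [← integral_fderiv_line hh (hp 0 (2 * (t • b 1)))]
      refine intervalIntegral.integral_congr fun s _ => ?_
      simp only [Complex.real_smul]
      congr 2
      ring
    · refine intervalIntegral.integral_zero_ae (.of_forall fun s _ => ?_)
      rw [← integral_fderiv_line hh (hp 1 (2 * (s • b 0)))]
      refine intervalIntegral.integral_congr fun t _ => ?_
      simp only [Complex.real_smul]
      congr 2
      ring
  have hv : ∀ z, fderiv ℝ h z v = ((b.repr v 0 / 2 : ℝ) : ℂ) * fderiv ℝ h z (2 * b 0)
      + ((b.repr v 1 / 2 : ℝ) : ℂ) * fderiv ℝ h z (2 * b 1) := by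
    intro z
    rw [← Complex.real_smul, ← Complex.real_smul, ← map_smul, ← map_smul, ← map_add]
    congr 1
    conv_lhs => rw [← b.sum_repr v]
    simp only [Fin.sum_univ_two, Complex.real_smul]
    push_cast; ring
  simp only [hv]
  rw [torusMean_add (by fun_prop) (by fun_prop), torusMean_const_mul, torusMean_const_mul, key, key]
  simp

/-! ### Scalar Fourier coefficients -/

/-- The conjugate wave `e ^ (-2 i π ⟨γ, z⟩)`. -/
def wave (γ z : ℂ) : ℂ := Complex.exp (-2 * Complex.I * Real.pi * ((inner ℝ γ z : ℝ) : ℂ))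

/-- The Fourier coefficient of a scalar `2Γ`-periodic function. -/
def scalarCoeff (b : Module.Basis (Fin 2) ℝ ℂ) (γ : ℂ) (f : ℂ → ℂ) : ℂ :=
  torusMean b fun z => wave γ z * f z

theorem fourierCoefficient_apply (b : Module.Basis (Fin 2) ℝ ℂ) (u : ℂ → Fin 4 → ℂ) (γ : ℂ)
    (i : Fin 4) : fourierCoefficient b u γ i = scalarCoeff b γ fun z => u z i := rfl

theorem wave_add (γ z w : ℂ) : wave γ (z + w) = wave γ z * wave γ w := by
  rw [wave, wave, wave, ← Complex.exp_add, inner_add_right]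
  push_cast; ring_nf

theorem wave_eq_one_iff {γ z : ℂ} : wave γ z = 1 ↔ ∃ n : ℤ, inner ℝ γ z = (n : ℝ) := by
  rw [wave, Complex.exp_eq_one_iff]
  have h2 : (2 * Real.pi * Complex.I : ℂ) ≠ 0 := Complex.two_pi_I_ne_zero
  constructor
  · rintro ⟨n, hn⟩
    refine ⟨-n, ?_⟩
    have h3 : (2 * Real.pi * Complex.I : ℂ) * ((inner ℝ γ z : ℝ) : ℂ)
        = (2 * Real.pi * Complex.I : ℂ) * ((-n : ℤ) : ℂ) := by
      push_cast; linear_combination -hn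
    exact_mod_cast mul_left_cancel₀ h2 h3
  · rintro ⟨n, hn⟩
    refine ⟨-n, ?_⟩
    rw [hn]; push_cast; ring

theorem contDiff_wave (γ : ℂ) : ContDiff ℝ ∞ (wave γ) := by
  have h : ContDiff ℝ ∞ fun z : ℂ => inner ℝ γ z := contDiff_const.inner ℝ contDiff_id
  exact Complex.contDiff_exp.comp
    (contDiff_const.mul (Complex.ofRealCLM.contDiff.comp h))

theorem hasFDerivAt_ofReal_inner (γ z : ℂ) :
    HasFDerivAt (fun z : ℂ => ((inner ℝ γ z : ℝ) : ℂ))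
      (Complex.ofRealCLM.comp (innerSL ℝ γ)) z :=
  (Complex.ofRealCLM.comp (innerSL ℝ γ)).hasFDerivAt

theorem fderiv_wave (γ z v : ℂ) :
    fderiv ℝ (wave γ) z v
      = -2 * Complex.I * Real.pi * ((inner ℝ γ v : ℝ) : ℂ) * wave γ z := by
  have h := ((hasFDerivAt_ofReal_inner γ z).const_mul (-2 * Complex.I * Real.pi)).cexp
  rw [show wave γ = fun z => Complex.exp (-2 * Complex.I * Real.pi * ((inner ℝ γ z : ℝ) : ℂ))
    from rfl, h.fderiv]
  simp
  ring

variable {γ : ℂ}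

theorem inner_two_mul_comm (γ z : ℂ) : (inner ℝ γ (2 * z) : ℝ) = inner ℝ (2 * γ) z := by
  simp [Complex.inner]; ring

theorem wave_two_mul_basis (hγ : 2 * γ ∈ dualLattice b) (i : Fin 2) : wave γ (2 * b i) = 1 := by
  obtain ⟨n, hn⟩ := hγ (b i) (Submodule.subset_span ⟨i, rfl⟩)
  exact wave_eq_one_iff.2 ⟨n, by rw [inner_two_mul_comm, hn]⟩

theorem doublyPeriodic_wave_mul (hγ : 2 * γ ∈ dualLattice b) (hf : DoublyPeriodic b f) :
    DoublyPeriodic b fun z => wave γ z * f z := fun i z => by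
  beta_reduce
  rw [wave_add, wave_two_mul_basis hγ, mul_one, hf]

theorem scalarCoeff_add (hf : Continuous f) (hg : Continuous g) :
    scalarCoeff b γ (fun z => f z + g z) = scalarCoeff b γ f + scalarCoeff b γ g := by
  have := (contDiff_wave γ).continuous
  simp only [scalarCoeff, mul_add]
  exact torusMean_add (by fun_prop) (by fun_prop)

theorem scalarCoeff_const_mul (a : ℂ) (f : ℂ → ℂ) :
    scalarCoeff b γ (fun z => a * f z) = a * scalarCoeff b γ f := by
  rw [scalarCoeff, scalarCoeff, ← torusMean_const_mul]
  congr 1 with z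
  ring

theorem scalarCoeff_sub (hf : Continuous f) (hg : Continuous g) :
    scalarCoeff b γ (fun z => f z - g z) = scalarCoeff b γ f - scalarCoeff b γ g := by
  have h := scalarCoeff_add (b := b) (γ := γ) hf (g := fun z => -1 * g z) (by fun_prop)
  rw [scalarCoeff_const_mul] at h
  simpa [sub_eq_add_neg] using h

/-- Integration by parts: the product of `f` with the conjugate wave is `2Γ`-periodic, so its
derivative has mean zero. -/
theorem scalarCoeff_fderiv (hγ : 2 * γ ∈ dualLattice b) (hf : ContDiff ℝ ∞ f)
    (hp : DoublyPeriodic b f) (v : ℂ) :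
    scalarCoeff b γ (fun z => fderiv ℝ f z v)
      = 2 * Complex.I * Real.pi * ((inner ℝ γ v : ℝ) : ℂ) * scalarCoeff b γ f := by
  have hw := contDiff_wave γ
  have h1 : (∞ : WithTop ℕ∞) ≠ 0 := by simp
  have hc := hf.continuous_fderiv h1
  have h0 := torusMean_fderiv ((hw.mul hf).of_le (by exact_mod_cast le_top))
    (doublyPeriodic_wave_mul hγ hp) v
  have h2 : ∀ z, fderiv ℝ (fun z => wave γ z * f z) z v = wave γ z * fderiv ℝ f z v
      + (-2 * Complex.I * Real.pi * ((inner ℝ γ v : ℝ) : ℂ)) * (wave γ z * f z) := by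
    intro z
    rw [fderiv_fun_mul (hw.differentiable h1 z) (hf.differentiable h1 z)]
    simp only [add_apply, smul_apply, fderiv_wave,
      smul_eq_mul]
    ring
  simp only [h2] at h0
  have hcw := hw.continuous
  have hcf := hf.continuous
  rw [torusMean_add (by fun_prop) (by fun_prop), torusMean_const_mul] at h0
  unfold scalarCoeff
  linear_combination h0

/-- Detects the finer translations by `Γ` on `2Γ`-periodic functions; a function that changes by a
sign under `b i` thereby constrains `γ` modulo `Γ*`. -/
theorem scalarCoeff_add_basis (hγ : 2 * γ ∈ dualLattice b) (hf : DoublyPeriodic b f) (i : Fin 2) :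
    wave γ (b i) * scalarCoeff b γ (fun z => f (z + b i)) = scalarCoeff b γ f := by
  rw [scalarCoeff, scalarCoeff, ← torusMean_add_basis (doublyPeriodic_wave_mul hγ hf) i,
    ← torusMean_const_mul]
  congr 1 with z
  rw [wave_add]
  ring

theorem mem_dualLattice_of_basis (h : ∀ i, ∃ n : ℤ, inner ℝ γ (b i) = (n : ℝ)) :
    γ ∈ dualLattice b := by
  intro g hg
  induction hg using Submodule.span_induction with
  | mem x hx => obtain ⟨i, rfl⟩ := hx; exact h i
  | zero => exact ⟨0, by simp⟩
  | add x y _ _ hx hy =>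
    obtain ⟨n, hn⟩ := hx
    obtain ⟨m, hm⟩ := hy
    exact ⟨n + m, by rw [inner_add_right, hn, hm]; push_cast; rfl⟩
  | smul k x _ hx =>
    obtain ⟨n, hn⟩ := hx
    exact ⟨k * n, by rw [← Int.cast_smul_eq_zsmul ℝ, inner_smul_right, hn]; push_cast; rfl⟩

/-! ### Wirtinger derivatives -/

/-- The derivative `∂f/∂z`. -/
def dz (f : ℂ → ℂ) (z : ℂ) : ℂ :=
  1 / 2 * (fderiv ℝ f z 1 - Complex.I * fderiv ℝ f z Complex.I)

/-- The derivative `∂f/∂z̄`. -/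
def dzbar (f : ℂ → ℂ) (z : ℂ) : ℂ :=
  1 / 2 * (fderiv ℝ f z 1 + Complex.I * fderiv ℝ f z Complex.I)

theorem scalarCoeff_dz (hγ : 2 * γ ∈ dualLattice b) (hf : ContDiff ℝ ∞ f)
    (hp : DoublyPeriodic b f) :
    scalarCoeff b γ (dz f) = Complex.I * Real.pi * starRingEnd ℂ γ * scalarCoeff b γ f := by
  have hc := hf.continuous_fderiv (by simp : (∞ : WithTop ℕ∞) ≠ 0)
  unfold dz
  rw [scalarCoeff_const_mul, scalarCoeff_sub (by fun_prop) (by fun_prop), scalarCoeff_const_mul,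
    scalarCoeff_fderiv hγ hf hp, scalarCoeff_fderiv hγ hf hp]
  have h : starRingEnd ℂ γ
      = ((inner ℝ γ 1 : ℝ) : ℂ) - Complex.I * ((inner ℝ γ Complex.I : ℝ) : ℂ) := by
    apply Complex.ext <;> simp [Complex.inner]
  rw [h]
  ring

theorem scalarCoeff_dzbar (hγ : 2 * γ ∈ dualLattice b) (hf : ContDiff ℝ ∞ f)
    (hp : DoublyPeriodic b f) :
    scalarCoeff b γ (dzbar f) = Complex.I * Real.pi * γ * scalarCoeff b γ f := by
  have hc := hf.continuous_fderiv (by simp : (∞ : WithTop ℕ∞) ≠ 0)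
  unfold dzbar
  rw [scalarCoeff_const_mul, scalarCoeff_add (by fun_prop) (by fun_prop), scalarCoeff_const_mul,
    scalarCoeff_fderiv hγ hf hp, scalarCoeff_fderiv hγ hf hp]
  have h : γ = ((inner ℝ γ 1 : ℝ) : ℂ) + Complex.I * ((inner ℝ γ Complex.I : ℝ) : ℂ) := by
    apply Complex.ext <;> simp [Complex.inner]
  linear_combination -(Complex.I * Real.pi * scalarCoeff b γ f) * h

theorem dz_conj (hf : ContDiff ℝ ∞ f) (z : ℂ) :
    dz (fun w => starRingEnd ℂ (f w)) z = starRingEnd ℂ (dzbar f z) := by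
  have h := (hf.differentiable (by simp) z).hasFDerivAt
  have h1 := (Complex.conjCLE.toContinuousLinearMap.hasFDerivAt (x := f z)).comp z h
  have h2 : HasFDerivAt (fun w => starRingEnd ℂ (f w)) _ z := h1
  rw [dz, dzbar, h2.fderiv]
  simp only [one_div, ContinuousLinearMap.comp_apply, map_mul, map_inv₀, map_ofNat, map_add,
    Complex.conj_I, ContinuousLinearEquiv.coe_coe, Complex.conjCLE_apply]
  ring

theorem doublyPeriodic_fderiv (hp : DoublyPeriodic b f) (v : ℂ) :
    DoublyPeriodic b fun z => fderiv ℝ f z v := fun i z => by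
  have h : (fun w => f (w + 2 * b i)) = f := funext fun w => hp i w
  beta_reduce
  rw [← fderiv_comp_add_right, h]

theorem doublyPeriodic_dz (hp : DoublyPeriodic b f) : DoublyPeriodic b (dz f) := fun i z => by
  have h := fun v => doublyPeriodic_fderiv hp v i z
  simp only [dz, h]

/-! ### Quaternionic identities -/

theorem cplx_Li : cplx Li = !![0, -1, 0, 0; 1, 0, 0, 0; 0, 0, 0, -1; 0, 0, 1, 0] := by
  ext i j; fin_cases i <;> fin_cases j <;> simp [cplx, Li]

theorem cplx_Lj : cplx Lj = !![0, 0, -1, 0; 0, 0, 0, 1; 1, 0, 0, 0; 0, -1, 0, 0] := by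
  ext i j; fin_cases i <;> fin_cases j <;> simp [cplx, Lj]

theorem Li_mul_Li : Li * Li = -1 := by
  ext i j; fin_cases i <;> fin_cases j <;> simp [Li, Matrix.mul_apply, Fin.sum_univ_four]

theorem cplx_Li_mul_cplx_Li : cplx Li * cplx Li = -1 := by
  rw [cplx_Li]
  ext i j; fin_cases i <;> fin_cases j <;> simp [Matrix.mul_apply, Fin.sum_univ_four]

theorem cplx_Lj_mul_cplx_Lj : cplx Lj * cplx Lj = -1 := by
  rw [cplx_Lj]
  ext i j; fin_cases i <;> fin_cases j <;> simp [Matrix.mul_apply, Fin.sum_univ_four]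

theorem cplx_Lj_mul_cplx_Li : cplx Lj * cplx Li = -(cplx Li * cplx Lj) := by
  rw [cplx_Lj, cplx_Li]
  ext i j; fin_cases i <;> fin_cases j <;> simp [Matrix.mul_apply, Fin.sum_univ_four]

theorem Li_mulVec_Li_mulVec (v : Fin 4 → ℂ) : cplx Li *ᵥ (cplx Li *ᵥ v) = -v := by
  rw [Matrix.mulVec_mulVec, cplx_Li_mul_cplx_Li, Matrix.neg_mulVec, Matrix.one_mulVec]

theorem Lj_mulVec_Lj_mulVec (v : Fin 4 → ℂ) : cplx Lj *ᵥ (cplx Lj *ᵥ v) = -v := by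
  rw [Matrix.mulVec_mulVec, cplx_Lj_mul_cplx_Lj, Matrix.neg_mulVec, Matrix.one_mulVec]

theorem Lj_mulVec_Li_mulVec (v : Fin 4 → ℂ) :
    cplx Lj *ᵥ (cplx Li *ᵥ v) = -(cplx Li *ᵥ (cplx Lj *ᵥ v)) := by
  rw [Matrix.mulVec_mulVec, cplx_Lj_mul_cplx_Li, Matrix.neg_mulVec, Matrix.mulVec_mulVec]

theorem Lj_Li_Lj : cplx Lj * cplx Li * cplx Lj = cplx Li := by
  rw [cplx_Lj_mul_cplx_Li, neg_mul, mul_assoc, cplx_Lj_mul_cplx_Lj]; simp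

theorem tau_Li (c : ℂ) (y : Fin 4 → ℂ) :
    tau (c • cplx Li, y) = (-(c • cplx Li), -(cplx Lj *ᵥ y)) := by
  simp [tau, Lj_Li_Lj]

theorem tau_iterate_two (c : ℂ) (y : Fin 4 → ℂ) :
    tau^[2] (c • cplx Li, y) = (c • cplx Li, -y) := by
  rw [Function.iterate_succ_apply', Function.iterate_one, tau_Li, ← neg_smul, tau_Li,
    Matrix.mulVec_neg, Lj_mulVec_Lj_mulVec]
  simp

theorem tau_iterate_three (c : ℂ) (y : Fin 4 → ℂ) :
    tau^[3] (c • cplx Li, y) = (-(c • cplx Li), cplx Lj *ᵥ y) := by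
  rw [Function.iterate_succ_apply', tau_iterate_two, tau_Li, Matrix.mulVec_neg, neg_neg]

theorem eigenProj_zero_Li (c : ℂ) (y : Fin 4 → ℂ) : eigenProj 0 (c • cplx Li, y) = 0 := by
  simp [eigenProj, Finset.sum_range_succ, tau_iterate_two, tau_iterate_three, tau_Li]

/-- `τ` negates `L_i`, so the rotation part lies in the eigenspace of `i² = -1`, while translations
only meet the eigenvalues `±i`. -/
theorem eigenProj_two_Li (c : ℂ) (y : Fin 4 → ℂ) :
    eigenProj 2 (c • cplx Li, y) = (c • cplx Li, 0) := by
  have h4 : Complex.I ^ (-4 : ℤ) = 1 := by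
    rw [zpow_neg]; norm_cast; rw [Complex.I_pow_four, inv_one]
  have h2 : Complex.I ^ (-2 : ℤ) = -1 := by
    rw [show (-2 : ℤ) = -1 + -1 by norm_num, zpow_add₀ Complex.I_ne_zero]; simp
  have h6 : Complex.I ^ (-6 : ℤ) = -1 := by
    rw [show (-6 : ℤ) = -4 + -2 by norm_num, zpow_add₀ Complex.I_ne_zero, h4, h2, one_mul]
  simp only [eigenProj, Finset.sum_range_succ, Finset.sum_range_zero, tau_iterate_two,
    tau_iterate_three, Function.iterate_one, Function.iterate_zero, id_eq, tau_Li]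
  norm_num [h4, h6, h2]
  module

theorem eigenProj_neg_one_Li (c : ℂ) {y : Fin 4 → ℂ} (hy : cplx Lj *ᵥ y = Complex.I • y) :
    eigenProj (-1) (c • cplx Li, y) = (0, y) := by
  have h3 : Complex.I ^ (3 : ℤ) = -Complex.I := by
    rw [show (3 : ℤ) = 1 + 1 + 1 by norm_num, zpow_add₀ Complex.I_ne_zero,
      zpow_add₀ Complex.I_ne_zero]; simp
  have h2 : Complex.I ^ (2 : ℤ) = -1 := by
    rw [show (2 : ℤ) = 1 + 1 by norm_num, zpow_add₀ Complex.I_ne_zero]; simp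
  simp only [eigenProj, Finset.sum_range_succ, Finset.sum_range_zero, tau_iterate_two,
    tau_iterate_three, Function.iterate_one, Function.iterate_zero, id_eq, tau_Li, hy]
  norm_num [h3, h2, smul_smul]
  module

theorem eigenProj_one_Li (c : ℂ) {y : Fin 4 → ℂ} (hy : cplx Lj *ᵥ y = -Complex.I • y) :
    eigenProj 1 (c • cplx Li, y) = (0, y) := by
  have h1 : Complex.I ^ (-1 : ℤ) = -Complex.I := by simp
  have h3 : Complex.I ^ (-3 : ℤ) = Complex.I := by
    rw [show (-3 : ℤ) = -1 + -1 + -1 by norm_num, zpow_add₀ Complex.I_ne_zero,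
      zpow_add₀ Complex.I_ne_zero]; simp
  have h2 : Complex.I ^ (-2 : ℤ) = -1 := by
    rw [show (-2 : ℤ) = -1 + -1 by norm_num, zpow_add₀ Complex.I_ne_zero]; simp
  simp only [eigenProj, Finset.sum_range_succ, Finset.sum_range_zero, tau_iterate_two,
    tau_iterate_three, Function.iterate_one, Function.iterate_zero, id_eq, tau_Li, hy]
  norm_num [h1, h3, h2, smul_smul]
  module

/-! ### The Maurer-Cartan form of the spinor lift -/

theorem cplx_smul (r : ℝ) (M : Matrix (Fin 4) (Fin 4) ℝ) : cplx (r • M) = (r : ℂ) • cplx M := by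
  ext i j; simp [cplx]

theorem spinor_inv (β : ℂ → ℝ) (z : ℂ) : (spinor β z)⁻¹
    = Real.cos (β z / 2) • (1 : Matrix (Fin 4) (Fin 4) ℝ) - Real.sin (β z / 2) • Li := by
  refine Matrix.inv_eq_left_inv ?_
  rw [spinor]
  simp only [sub_mul, mul_add, smul_mul_assoc, mul_smul_comm, one_mul, mul_one, Li_mul_Li]
  have := Real.cos_sq_add_sin_sq (β z / 2)
  have h2 : (1 : Matrix (Fin 4) (Fin 4) ℝ)
      = (Real.cos (β z / 2) ^ 2 + Real.sin (β z / 2) ^ 2) • 1 := by rw [this, one_smul]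
  conv_rhs => rw [h2]
  module

variable {β₀ : ℂ} {θ : ℝ}

theorem hasFDerivAt_affineAngle (z : ℂ) :
    HasFDerivAt (affineAngle β₀ θ) ((2 * Real.pi) • innerSL ℝ β₀) z :=
  (((innerSL ℝ β₀).hasFDerivAt (x := z)).const_mul (2 * Real.pi)).add_const θ

theorem spinor_inv_mul_fderiv (z v : ℂ) :
    (spinor (affineAngle β₀ θ) z)⁻¹
        * Matrix.of (fun i j => fderiv ℝ (fun w => spinor (affineAngle β₀ θ) w i j) z v)
      = (Real.pi * inner ℝ β₀ v) • Li := by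
  have hd : Matrix.of (fun i j => fderiv ℝ (fun w => spinor (affineAngle β₀ θ) w i j) z v)
      = (Real.pi * inner ℝ β₀ v) • (Real.cos (affineAngle β₀ θ z / 2) • Li
        - Real.sin (affineAngle β₀ θ z / 2) • (1 : Matrix (Fin 4) (Fin 4) ℝ)) := by
    ext i j
    have h0 : HasFDerivAt (fun w => affineAngle β₀ θ w / 2) _ z :=
      (hasFDerivAt_affineAngle (β₀ := β₀) (θ := θ) z).mul_const (2⁻¹ : ℝ)
    have h : HasFDerivAt (fun w => spinor (affineAngle β₀ θ) w i j) _ z :=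
      (h0.cos.mul_const ((1 : Matrix (Fin 4) (Fin 4) ℝ) i j)).add (h0.sin.mul_const (Li i j))
    rw [Matrix.of_apply, h.fderiv]
    simp
    ring
  rw [hd, spinor_inv, mul_smul_comm]
  congr 1
  simp only [sub_mul, mul_sub, smul_mul_assoc, mul_smul_comm, one_mul, mul_one, Li_mul_Li]
  have := Real.cos_sq_add_sin_sq (affineAngle β₀ θ z / 2)
  have h2 : Li
      = (Real.cos (affineAngle β₀ θ z / 2) ^ 2 + Real.sin (affineAngle β₀ θ z / 2) ^ 2) • Li := by
    rw [this, one_smul]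
  conv_rhs => rw [h2]
  module

variable {X : ℂ → Fin 4 → ℝ}

theorem maurerCartan_spinor (z v : ℂ) :
    maurerCartan (spinor (affineAngle β₀ θ)) X z v = (((Real.pi * inner ℝ β₀ v : ℝ) : ℂ) • cplx Li,
      fun i => ((((spinor (affineAngle β₀ θ) z)⁻¹ *ᵥ fderiv ℝ X z v) i : ℝ) : ℂ)) := by
  rw [maurerCartan, spinor_inv_mul_fderiv, cplx_smul]

theorem formDz_maurerCartan (z : ℂ) : formDz (maurerCartan (spinor (affineAngle β₀ θ)) X) z
    = ((Real.pi * starRingEnd ℂ β₀ / 2) • cplx Li, uVec X (affineAngle β₀ θ) z) := by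
  refine Prod.ext ?_ rfl
  have h : starRingEnd ℂ β₀
      = ((inner ℝ β₀ 1 : ℝ) : ℂ) - Complex.I * ((inner ℝ β₀ Complex.I : ℝ) : ℂ) := by
    apply Complex.ext <;> simp [Complex.inner]
  simp only [formDz, maurerCartan_spinor, Prod.smul_mk, Prod.mk_sub_mk, h]
  push_cast
  module

theorem formDzbar_maurerCartan (z : ℂ) : formDzbar (maurerCartan (spinor (affineAngle β₀ θ)) X) z
    = ((Real.pi * β₀ / 2) • cplx Li,
        fun i => starRingEnd ℂ (uVec X (affineAngle β₀ θ) z i)) := by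
  refine Prod.ext ?_ ?_
  · have h : β₀ = ((inner ℝ β₀ 1 : ℝ) : ℂ) + Complex.I * ((inner ℝ β₀ Complex.I : ℝ) : ℂ) := by
      apply Complex.ext <;> simp [Complex.inner]
    conv_rhs => rw [h]
    simp only [formDzbar, maurerCartan_spinor, Prod.smul_mk, Prod.mk_add_mk]
    push_cast
    module
  · ext i
    simp [uVec, formDz, formDzbar, maurerCartan_spinor, Complex.conj_ofNat]
    ring

/-- Under `L_j u = iu` the translation `u` has `τ`-eigenvalue `-i` and `ū` has `i`, so nothing is
lost in the projections: `α_λ` is `α` with powers of `λ` inserted, and its rotation part is a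
multiple of `L_i`. -/
theorem extendedForm_maurerCartan {z : ℂ}
    (hu : cplx Lj *ᵥ uVec X (affineAngle β₀ θ) z = Complex.I • uVec X (affineAngle β₀ θ) z)
    (lam v : ℂ) :
    extendedForm (maurerCartan (spinor (affineAngle β₀ θ)) X) lam z v
      = ((lam ^ (-2 : ℤ) * v * (Real.pi * starRingEnd ℂ β₀ / 2)
            + lam ^ 2 * starRingEnd ℂ v * (Real.pi * β₀ / 2)) • cplx Li,
          (lam ^ (-1 : ℤ) * v) • uVec X (affineAngle β₀ θ) z
            + (lam * starRingEnd ℂ v)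
              • fun i => starRingEnd ℂ (uVec X (affineAngle β₀ θ) z i)) := by
  have hub : cplx Lj *ᵥ (fun i => starRingEnd ℂ (uVec X (affineAngle β₀ θ) z i))
      = -Complex.I • fun i => starRingEnd ℂ (uVec X (affineAngle β₀ θ) z i) := by
    ext i
    have := congrArg (starRingEnd ℂ) (congrFun hu i)
    rw [cplx_Lj] at this ⊢
    fin_cases i <;> simpa [Matrix.mulVec, dotProduct, Fin.sum_univ_four] using this
  rw [extendedForm, formDz_maurerCartan, formDzbar_maurerCartan, maurerCartan_spinor,
    eigenProj_zero_Li, eigenProj_two_Li, eigenProj_two_Li, eigenProj_neg_one_Li _ hu,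
    eigenProj_one_Li _ hub]
  refine Prod.ext ?_ ?_
  · simp only [Prod.fst_add, Prod.smul_fst, Prod.fst_zero]; module
  · simp only [Prod.snd_add, Prod.smul_snd, Prod.snd_zero]; module

/-! ### Real twisted loops -/

/-- Stated for an arbitrary linear functional so that matrix entries, compositions with `τ`, and
defects such as commutators with `L_i` are all covered. -/
theorem hasLaurent_loopEval {d : ℕ} {c : ℤ → GC} (hc : ∀ n : ℤ, (d : ℤ) < |n| → c n = 0)
    {φ : GC → ℂ} (hφ : IsLinearMap ℂ φ) :
    HasLaurent (fun l => φ (loopEval d c l)) (fun n => φ (c n)) := by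
  have h := hasLaurent_sum (d := d) (c := fun n => φ (c n))
    (fun n hn => by rw [hc n hn, hφ.map_zero])
  convert h using 2 with l
  rw [loopEval, ← hφ.mk'_apply, map_sum]
  simp

theorem isLinearMap_rot (i j : Fin 4) : IsLinearMap ℂ fun x : GC => x.1 i j :=
  ⟨fun _ _ => rfl, fun _ _ => rfl⟩

theorem isLinearMap_trans (i : Fin 4) : IsLinearMap ℂ fun x : GC => x.2 i :=
  ⟨fun _ _ => rfl, fun _ _ => rfl⟩

namespace IsRealTwistedLoop

variable {d : ℕ} {c : ℤ → GC}

theorem tau_eq (h : IsRealTwistedLoop d c) (n : ℤ) : tau (c n) = Complex.I ^ n • c n := by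
  have key : ∀ φ : GC → ℂ, IsLinearMap ℂ φ → φ (tau (c n)) = φ (Complex.I ^ n • c n) := by
    intro φ hφ
    have hτ : IsLinearMap ℂ fun x => φ (tau x) := by
      constructor
      · intro x y
        rw [← hφ.map_add]; congr 1
        simp [tau, mul_add, add_mul, Matrix.mulVec_add, add_comm]
      · intro a x
        rw [← hφ.map_smul]; congr 1
        simp [tau, Matrix.mulVec_smul]
    have h1 := hasLaurent_loopEval h.degree hτ
    have h2 := hasLaurent_loopEval (c := fun n => Complex.I ^ n • c n)
      (fun n hn => by rw [h.degree n hn, smul_zero]) hφ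
    refine h1.unique h2 (fun l hl => ?_) n
    rw [← h.twisted l hl]
    simp only [loopEval, mul_zpow, smul_smul, mul_comm]
  refine Prod.ext ?_ ?_
  · ext i j; exact key _ (isLinearMap_rot i j)
  · ext i; exact key _ (isLinearMap_trans i)

theorem rot_antisymm (h : IsRealTwistedLoop d c) (n : ℤ) (i j : Fin 4) :
    (c n).1 i j + (c n).1 j i = 0 := by
  refine (hasLaurent_loopEval h.degree (φ := fun x => x.1 i j + x.1 j i) ⟨?_, ?_⟩).eq_zero ?_ n
  · intro x y; simp; ring
  · intro a x; simp; ring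
  · intro l hl
    obtain ⟨a, b₁, b₂, b₃, t, ht⟩ := h.real l hl
    rw [ht]
    -- All four generators of the rotation part of `𝔤` are antisymmetric.
    fin_cases i <;> fin_cases j <;> simp [cplx, Li, Ri, Rj, Rk] <;> ring

theorem rot_commute (h : IsRealTwistedLoop d c) (n : ℤ) :
    (c n).1 * cplx Li = cplx Li * (c n).1 := by
  ext i j
  rw [← sub_eq_zero]
  refine (hasLaurent_loopEval h.degree
    (φ := fun x => (x.1 * cplx Li) i j - (cplx Li * x.1) i j) ⟨?_, ?_⟩).eq_zero ?_ n
  · intro x y; simp [add_mul, mul_add]; ring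
  · intro a x; simp; ring
  · intro l hl
    obtain ⟨a, b₁, b₂, b₃, t, ht⟩ := h.real l hl
    rw [ht, cplx_Li]
    fin_cases i <;> fin_cases j <;>
      simp [cplx, Li, Ri, Rj, Rk, Matrix.mul_apply, Fin.sum_univ_four] <;> ring

theorem rot_conj (h : IsRealTwistedLoop d c) (n : ℤ) :
    (c n).1 1 0 = starRingEnd ℂ ((c (-n)).1 1 0) := by
  have h1 := hasLaurent_loopEval h.degree (isLinearMap_rot 1 0)
  refine h1.unique h1.conj (fun l hl => ?_) n
  obtain ⟨a, b₁, b₂, b₃, t, ht⟩ := h.real l hl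
  rw [ht]
  exact (Complex.conj_ofReal _).symm

theorem tau_tau (x : GC) : tau (tau x) = (x.1, -x.2) := by
  refine Prod.ext ?_ ?_
  · simp only [tau, mul_neg, neg_mul, neg_neg]
    rw [← mul_assoc, ← mul_assoc, cplx_Lj_mul_cplx_Lj, mul_assoc, cplx_Lj_mul_cplx_Lj]
    simp
  · simp only [tau, Matrix.mulVec_neg, Lj_mulVec_Lj_mulVec, neg_neg]

/-- `τ²` fixes rotations and negates translations, and it acts on the coefficient of `λⁿ` by
`(-1)ⁿ`; so rotations sit at even exponents and translations at odd ones. -/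
theorem tau_tau_eq (h : IsRealTwistedLoop d c) (n : ℤ) :
    ((c n).1, -(c n).2) = ((-1 : ℂ) ^ n) • c n := by
  have hs : ∀ (a : ℂ) (x : GC), tau (a • x) = a • tau x := fun a x => by
    simp [tau, Matrix.mulVec_smul]
  rw [← tau_tau, h.tau_eq, hs, h.tau_eq, smul_smul, ← mul_zpow, Complex.I_mul_I]

theorem trans_eq_zero (h : IsRealTwistedLoop d c) {n : ℤ} (hn : Even n) : (c n).2 = 0 := by
  have h1 := congrArg Prod.snd (h.tau_tau_eq n)
  rw [hn.neg_one_zpow, one_smul] at h1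
  exact self_eq_neg.1 h1.symm

theorem rot_eq_zero (h : IsRealTwistedLoop d c) {n : ℤ} (hn : Odd n) : (c n).1 = 0 := by
  have h1 := congrArg Prod.fst (h.tau_tau_eq n)
  rw [hn.neg_one_zpow, neg_one_smul] at h1
  ext i j
  exact self_eq_neg.1 (congrFun (congrFun h1 i) j)

/-- Only exponents `≡ 2 mod 4` matter. There the rotation part is antisymmetric, commutes with `L_i`
and anticommutes with `L_j`; the first two conditions leave `L_i` and the `R`'s, and the last
removes the `R`'s, which commute with `L_j`. The entry `(1, 0)` of `L_i` is `1`, so that entry reads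
off the coefficient. -/
theorem rot_eq (h : IsRealTwistedLoop d c) (h4 : ∀ n : ℤ, (4 : ℤ) ∣ n → c n = 0) (n : ℤ) :
    (c n).1 = (c n).1 1 0 • cplx Li := by
  rcases Int.even_or_odd n with he | ho
  · by_cases hd : (4 : ℤ) ∣ n
    · rw [h4 n hd]; simp
    · obtain ⟨k, rfl⟩ : ∃ k, n = 4 * k + 2 := ⟨n / 4, by rcases he with ⟨m, rfl⟩; omega⟩
      have hI : Complex.I ^ (4 * k + 2) = -1 := by
        have h4 : Complex.I ^ (4 : ℤ) = 1 := by norm_cast; exact Complex.I_pow_four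
        have h2 : Complex.I ^ (2 : ℤ) = -1 := Complex.I_sq
        rw [zpow_add₀ Complex.I_ne_zero, zpow_mul, h4, h2, one_zpow, one_mul]
      have h1 := congrArg Prod.fst (h.tau_eq (4 * k + 2))
      rw [hI] at h1
      have h2 := h.rot_commute (4 * k + 2)
      have h3 := h.rot_antisymm (4 * k + 2)
      generalize c (4 * k + 2) = x at h1 h2 h3
      have h1' : x.1 * cplx Lj = -(cplx Lj * x.1) := by
        have h5 : cplx Lj * x.1 * cplx Lj = x.1 := by simpa [tau] using h1
        calc x.1 * cplx Lj = -(cplx Lj * cplx Lj) * (x.1 * cplx Lj) := by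
              rw [cplx_Lj_mul_cplx_Lj]; simp
          _ = -(cplx Lj * (cplx Lj * x.1 * cplx Lj)) := by noncomm_ring
          _ = _ := by rw [h5]
      rw [cplx_Lj] at h1'
      rw [cplx_Li] at h2 ⊢
      have e1 := fun i j => congrFun (congrFun h1' i) j
      have e2 := fun i j => congrFun (congrFun h2 i) j
      clear h1 h1' h2
      simp [Fin.forall_fin_succ, Matrix.mul_apply, Matrix.vecMul, dotProduct,
        Fin.sum_univ_four] at e1 e2 h3
      clear h4 he hd hI
      ext i j
      fin_cases i <;> fin_cases j <;> simp <;> grind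
  · rw [h.rot_eq_zero ho]; simp

end IsRealTwistedLoop

theorem liCoeff_smul (w : ℂ) (t : Fin 4 → ℂ) : liCoeff (w • cplx Li, t) = w := by
  simp [liCoeff, cplx_Li_mul_cplx_Li]
  ring

/-! ### Vector valued Fourier coefficients -/

section

variable {b : Module.Basis (Fin 2) ℝ ℂ} {γ : ℂ} {u v : ℂ → Fin 4 → ℂ}

theorem fourierCoefficient_mulVec (M : Matrix (Fin 4) (Fin 4) ℂ)
    (hu : ∀ i, Continuous fun z => u z i) :
    fourierCoefficient b (fun z => M *ᵥ u z) γ = M *ᵥ fourierCoefficient b u γ := by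
  ext i
  have h0 := hu 0
  have h1 := hu 1
  have h2 := hu 2
  have h3 := hu 3
  simp only [fourierCoefficient_apply, Matrix.mulVec, dotProduct, Fin.sum_univ_four]
  rw [scalarCoeff_add (by fun_prop) (by fun_prop), scalarCoeff_add (by fun_prop) (by fun_prop),
    scalarCoeff_add (by fun_prop) (by fun_prop)]
  simp only [scalarCoeff_const_mul]

theorem fourierCoefficient_const_smul (a : ℂ) (u : ℂ → Fin 4 → ℂ) :
    fourierCoefficient b (fun z => a • u z) γ = a • fourierCoefficient b u γ := by
  ext i
  simp only [fourierCoefficient_apply, Pi.smul_apply, smul_eq_mul, scalarCoeff_const_mul]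

theorem fourierCoefficient_add (hu : ∀ i, Continuous fun z => u z i)
    (hv : ∀ i, Continuous fun z => v z i) :
    fourierCoefficient b (fun z => u z + v z) γ
      = fourierCoefficient b u γ + fourierCoefficient b v γ := by
  ext i
  simp only [fourierCoefficient_apply, Pi.add_apply, scalarCoeff_add (hu i) (hv i)]

theorem fourierCoefficient_dz (hγ : 2 * γ ∈ dualLattice b) (hu : ∀ i, ContDiff ℝ ∞ fun z => u z i)
    (hp : ∀ i, DoublyPeriodic b fun z => u z i) :
    fourierCoefficient b (fun z i => dz (fun w => u w i) z) γ
      = (Complex.I * Real.pi * starRingEnd ℂ γ) • fourierCoefficient b u γ := by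
  ext i
  exact scalarCoeff_dz hγ (hu i) (hp i)

theorem fourierCoefficient_dzbar (hγ : 2 * γ ∈ dualLattice b)
    (hu : ∀ i, ContDiff ℝ ∞ fun z => u z i) (hp : ∀ i, DoublyPeriodic b fun z => u z i) :
    fourierCoefficient b (fun z i => dzbar (fun w => u w i) z) γ
      = (Complex.I * Real.pi * γ) • fourierCoefficient b u γ := by
  ext i
  exact scalarCoeff_dzbar hγ (hu i) (hp i)

end

/-! ### Periodicity of the lift -/

section

variable {b : Module.Basis (Fin 2) ℝ ℂ} {β₀ g : ℂ} {θ : ℝ} {X : ℂ → Fin 4 → ℝ}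

theorem fderiv_add_period (hper : ∀ z, X (z + g) = X z) (z : ℂ) :
    fderiv ℝ X (z + g) = fderiv ℝ X z := by
  rw [← fderiv_comp_add_right, funext hper]

theorem affineAngle_add (z g : ℂ) :
    affineAngle β₀ θ (z + g) = affineAngle β₀ θ z + 2 * Real.pi * inner ℝ β₀ g := by
  rw [affineAngle, affineAngle, inner_add_right]; ring

/-- The complex volume of `(X_x, X_y)` is periodic and `X_x ≠ 0`, so `e^{iβ}` is periodic although
`β` need not be. -/
theorem exists_int_of_angle (hX : IsConformalLagrangianImmersion X)
    (hβ : IsLagrangianAngle X (affineAngle β₀ θ)) (hper : ∀ z, X (z + g) = X z) :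
    ∃ n : ℤ, inner ℝ β₀ g = (n : ℝ) := by
  have h1 := hβ 0
  have h2 := hβ (0 + g)
  rw [fderiv_add_period hper, h1] at h2
  have h3 : ((fderiv ℝ X 0 1 ⬝ᵥ fderiv ℝ X 0 1 : ℝ) : ℂ) ≠ 0 := by
    rw [Complex.ofReal_ne_zero, Ne, dotProduct_self_eq_zero]
    exact hX.immersion 0
  have h4 := mul_left_cancel₀ h3 h2
  rw [affineAngle_add, Complex.ofReal_add, mul_add, Complex.exp_add] at h4
  have h5 : Complex.exp (Complex.I * ((2 * Real.pi * inner ℝ β₀ g : ℝ) : ℂ)) = 1 :=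
    mul_left_cancel₀ (Complex.exp_ne_zero _) (by rw [← h4, mul_one])
  rw [← wave_eq_one_iff, wave, ← inv_eq_one, ← Complex.exp_neg, ← h5]
  congr 1
  push_cast; ring

theorem spinor_inv_add {n : ℤ} (hn : inner ℝ β₀ g = (n : ℝ)) (z : ℂ) :
    (spinor (affineAngle β₀ θ) (z + g))⁻¹
      = ((-1 : ℝ) ^ n) • (spinor (affineAngle β₀ θ) z)⁻¹ := by
  have h : affineAngle β₀ θ (z + g) / 2 = affineAngle β₀ θ z / 2 + n * Real.pi := by
    rw [affineAngle_add, hn]; ring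
  rw [spinor_inv, spinor_inv, h, Real.cos_add_int_mul_pi, Real.sin_add_int_mul_pi, smul_sub,
    smul_smul, smul_smul]

theorem uVec_add {n : ℤ} (hn : inner ℝ β₀ g = (n : ℝ)) (hper : ∀ z, X (z + g) = X z) (z : ℂ) :
    uVec X (affineAngle β₀ θ) (z + g) = ((-1 : ℂ) ^ n) • uVec X (affineAngle β₀ θ) z := by
  ext i
  simp only [uVec, formDz, maurerCartan_spinor, fderiv_add_period hper, spinor_inv_add hn,
    Matrix.smul_mulVec]
  simp
  ring

theorem doublyPeriodic_uVec (hX : IsConformalLagrangianImmersion X)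
    (hβ : IsLagrangianAngle X (affineAngle β₀ θ))
    (hper : ∀ g ∈ lattice b, ∀ z, X (z + g) = X z) (i : Fin 4) :
    DoublyPeriodic b fun z => uVec X (affineAngle β₀ θ) z i := by
  intro j z
  have hg := hper (b j) (Submodule.subset_span ⟨j, rfl⟩)
  obtain ⟨n, hn⟩ := exists_int_of_angle hX hβ hg
  beta_reduce
  rw [two_mul, ← add_assoc, uVec_add hn hg, uVec_add hn hg, smul_smul, ← mul_zpow]
  simp

theorem wave_neg_half {n : ℤ} (hn : inner ℝ β₀ g = (n : ℝ)) : wave (-(β₀ / 2)) g = (-1) ^ n := by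
  have h : (inner ℝ (-(β₀ / 2)) g : ℝ) = -(n / 2) := by
    rw [← hn, show -(β₀ / 2) = (-1 / 2 : ℝ) • β₀ by rw [Complex.real_smul]; push_cast; ring,
      real_inner_smul_left]
    ring
  rw [wave, h, ← Complex.exp_pi_mul_I, ← Complex.exp_int_mul]
  congr 1
  push_cast; ring

/-- Translation by `b j` multiplies `u` by `(-1)ⁿ` with `n = ⟨β₀, b j⟩`, which is also the value at
`b j` of the wave of frequency `-β₀/2`. A nonzero coefficient thus forces the wave of `γ - β₀/2` to
be `1` there. -/
theorem sub_mem_dualLattice_of_fourierCoefficient_ne_zero (hX : IsConformalLagrangianImmersion X)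
    (hβ : IsLagrangianAngle X (affineAngle β₀ θ))
    (hper : ∀ g ∈ lattice b, ∀ z, X (z + g) = X z) {γ : ℂ}
    (hγ : γ ∈ frequencies b (uVec X (affineAngle β₀ θ))) : γ - β₀ / 2 ∈ dualLattice b := by
  refine mem_dualLattice_of_basis fun j => wave_eq_one_iff.1 ?_
  have hg := hper (b j) (Submodule.subset_span ⟨j, rfl⟩)
  obtain ⟨n, hn⟩ := exists_int_of_angle hX hβ hg
  obtain ⟨i, hi⟩ := Function.ne_iff.1 hγ.2
  rw [fourierCoefficient_apply] at hi
  have h1 := scalarCoeff_add_basis hγ.1 (doublyPeriodic_uVec hX hβ hper i) j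
  simp only [uVec_add hn hg, Pi.smul_apply, smul_eq_mul, scalarCoeff_const_mul] at h1
  have h2 : wave γ (b j) * (-1) ^ n = 1 := mul_right_cancel₀ hi (by rw [mul_assoc, h1, one_mul])
  rw [← h2, ← wave_neg_half hn, wave, wave, wave, ← Complex.exp_add, sub_eq_add_neg,
    inner_add_left]
  congr 1
  push_cast; ring

/-! ### The frequencies `± β₀ / 2` -/

theorem uVec_eq (hX : IsConformalLagrangianImmersion X) (z : ℂ) :
    uVec X (affineAngle β₀ θ) z
      = Complex.cos (affineAngle β₀ θ z / 2) • (fun i => dz (fun w => (X w i : ℂ)) z)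
        - Complex.sin (affineAngle β₀ θ z / 2)
          • (cplx Li *ᵥ fun i => dz (fun w => (X w i : ℂ)) z) := by
  have hd : ∀ i v, fderiv ℝ (fun w => (X w i : ℂ)) z v = ((fderiv ℝ X z v i : ℝ) : ℂ) := by
    intro i v
    have h1 := (hX.smooth.differentiable (by simp) z).hasFDerivAt
    have h2 := hasFDerivAt_pi'.1 h1 i
    have h3 : HasFDerivAt (fun w => (X w i : ℂ)) _ z := Complex.ofRealCLM.hasFDerivAt.comp z h2
    rw [h3.fderiv]
    rfl
  ext i
  simp only [dz, hd, uVec, formDz, maurerCartan_spinor, spinor_inv, Matrix.sub_mulVec,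
    Matrix.smul_mulVec, Matrix.one_mulVec]
  rw [cplx_Li]
  fin_cases i <;> simp [Li, dotProduct, Fin.sum_univ_four] <;> ring

/-- `1 + εiL_i` maps into the eigenspace `L_i = -εi`, where the spinor factor `e^{-βL_i/2}` is the
scalar `e^{εiβ/2}`. -/
theorem uVec_add_I_smul (hX : IsConformalLagrangianImmersion X) {ε : ℂ} (hε : ε ^ 2 = 1) (z : ℂ) :
    uVec X (affineAngle β₀ θ) z
        + (ε * Complex.I) • (cplx Li *ᵥ uVec X (affineAngle β₀ θ) z)
      = Complex.exp (ε * Complex.I * (affineAngle β₀ θ z / 2))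
        • ((fun i => dz (fun w => (X w i : ℂ)) z)
          + (ε * Complex.I) • (cplx Li *ᵥ fun i => dz (fun w => (X w i : ℂ)) z)) := by
  have he : Complex.exp (ε * Complex.I * (affineAngle β₀ θ z / 2))
      = Complex.cos (affineAngle β₀ θ z / 2)
        + ε * Complex.I * Complex.sin (affineAngle β₀ θ z / 2) := by
    rcases sq_eq_sq_iff_eq_or_eq_neg.1 (hε.trans (one_pow 2).symm) with rfl | rfl
    · rw [one_mul, mul_comm, Complex.exp_mul_I]; ring
    · rw [show -1 * Complex.I * ((affineAngle β₀ θ z : ℂ) / 2)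
        = (-((affineAngle β₀ θ z : ℂ) / 2)) * Complex.I by ring, Complex.exp_mul_I,
        Complex.cos_neg, Complex.sin_neg]; ring
  rw [uVec_eq hX, he]
  generalize (fun i => dz (fun w => (X w i : ℂ)) z) = D
  simp only [Matrix.mulVec_sub, Matrix.mulVec_smul, Li_mulVec_Li_mulVec]
  ext i
  simp only [Pi.add_apply, Pi.sub_apply, Pi.smul_apply, Pi.neg_apply, smul_eq_mul]
  linear_combination (-(Complex.sin (affineAngle β₀ θ z / 2)) * (cplx Li *ᵥ D) i * ε ^ 2)
    * Complex.I_sq + Complex.sin (affineAngle β₀ θ z / 2) * (cplx Li *ᵥ D) i * hε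

end

/-! ### Consequences of the Lax equation -/

namespace IsFiniteTypeSolution

variable {p : ℕ} {β₀ : ℂ} {θ : ℝ} {X : ℂ → Fin 4 → ℝ} {ξ : ℤ → ℂ → GC}

theorem rot_eq (hX : IsFiniteTypeSolution (4 * p + 2) X (affineAngle β₀ θ) ξ) (n : ℤ) (z : ℂ) :
    (ξ n z).1 = (ξ n z).1 1 0 • cplx Li :=
  (hX.loop z).rot_eq (fun m hm => hX.normalized m hm z) n

theorem uVec_eq (hX : IsFiniteTypeSolution (4 * p + 2) X (affineAngle β₀ θ) ξ) (z : ℂ) :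
    uVec X (affineAngle β₀ θ) z = (ξ (-(4 * p + 2) + 1) z).2 := by
  have h := congrArg Prod.snd (hX.adapted z)
  rw [Prod.snd_add, (hX.loop z).trans_eq_zero (n := -((4 * p + 2 : ℕ) : ℤ))
    ⟨-(2 * p + 1), by push_cast; ring⟩, zero_add] at h
  rw [uVec, h]
  push_cast
  rfl

theorem first_coeff (hX : IsFiniteTypeSolution (4 * p + 2) X (affineAngle β₀ θ) ξ) (z : ℂ) :
    (ξ (-(4 * p + 2)) z).1 1 0 = Real.pi * starRingEnd ℂ β₀ / 2 := by
  have h := congrArg Prod.fst (hX.adapted z)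
  rw [Prod.fst_add, (hX.loop z).rot_eq_zero (n := -((4 * p + 2 : ℕ) : ℤ) + 1)
    ⟨-(2 * p + 1), by push_cast; ring⟩, add_zero, formDz_maurerCartan] at h
  have h2 := congrFun (congrFun h 1) 0
  push_cast at h2
  rw [← h2]
  simp [cplx_Li]

theorem last_coeff (hX : IsFiniteTypeSolution (4 * p + 2) X (affineAngle β₀ θ) ξ) (z : ℂ) :
    (ξ (4 * p + 2) z).1 1 0 = Real.pi * β₀ / 2 := by
  rw [(hX.loop z).rot_conj (4 * p + 2), hX.first_coeff z]
  simp [Complex.conj_ofNat]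

theorem Lj_uVec (hX : IsFiniteTypeSolution (4 * p + 2) X (affineAngle β₀ θ) ξ) (z : ℂ) :
    cplx Lj *ᵥ uVec X (affineAngle β₀ θ) z = Complex.I • uVec X (affineAngle β₀ θ) z := by
  have h := congrArg Prod.snd ((hX.loop z).tau_eq (-(4 * p + 2) + 1))
  have hI : Complex.I ^ (-(4 * p + 2) + 1 : ℤ) = -Complex.I := by
    have h4 : Complex.I ^ (4 : ℤ) = 1 := by norm_cast; exact Complex.I_pow_four
    rw [show (-(4 * p + 2) + 1 : ℤ) = 4 * (-p) + -1 by ring, zpow_add₀ Complex.I_ne_zero, zpow_mul,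
      h4, one_zpow, one_mul]
    simp
  rw [hI] at h
  rw [hX.uVec_eq]
  simpa [tau] using h

theorem coeff_eq_zero (hX : IsFiniteTypeSolution (4 * p + 2) X (affineAngle β₀ θ) ξ) {n : ℤ}
    (hn : 4 * p + 2 < |n|) (z : ℂ) : ξ n z = 0 :=
  (hX.loop z).degree n (by exact_mod_cast hn)

theorem hasLaurent_fderiv (hX : IsFiniteTypeSolution (4 * p + 2) X (affineAngle β₀ θ) ξ)
    {φ : GC → ℂ} (hφ : IsLinearMap ℂ φ) (hd : ∀ n, Differentiable ℝ fun w => φ (ξ n w))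
    (z v : ℂ) :
    HasLaurent (fun l => fderiv ℝ (fun w => φ (loopEval (4 * p + 2) (fun n => ξ n w) l)) z v)
      (fun n => fderiv ℝ (fun w => φ (ξ n w)) z v) := by
  have h := hasLaurent_sum (d := 4 * p + 2) (c := fun n => fderiv ℝ (fun w => φ (ξ n w)) z v)
    (fun n hn => by
      have : (fun w => φ (ξ n w)) = fun _ => 0 := by
        ext w; rw [hX.coeff_eq_zero (by exact_mod_cast hn), hφ.map_zero]
      rw [this]; simp)
  convert h using 2 with l
  have h2 : (fun w => φ (loopEval (4 * p + 2) (fun n => ξ n w) l))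
      = fun w => ∑ n ∈ Finset.Icc (-((4 * p + 2 : ℕ) : ℤ)) ((4 * p + 2 : ℕ) : ℤ),
        l ^ n * φ (ξ n w) := by
    ext w
    rw [loopEval, ← hφ.mk'_apply, map_sum]
    simp
  rw [h2, fderiv_fun_sum fun n _ => ((hd n).const_mul _) z]
  simp only [sum_apply]
  refine Finset.sum_congr rfl fun n _ => ?_
  rw [fderiv_const_mul (hd n z)]
  rfl

theorem loopEval_rot (hX : IsFiniteTypeSolution (4 * p + 2) X (affineAngle β₀ θ) ξ) (z l : ℂ) :
    (loopEval (4 * p + 2) (fun n => ξ n z) l).1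
      = (loopEval (4 * p + 2) (fun n => ξ n z) l).1 1 0 • cplx Li := by
  have h : (loopEval (4 * p + 2) (fun n => ξ n z) l).1
      = (∑ n ∈ Finset.Icc (-((4 * p + 2 : ℕ) : ℤ)) ((4 * p + 2 : ℕ) : ℤ),
        l ^ n * (ξ n z).1 1 0) • cplx Li := by
    rw [loopEval, Prod.fst_sum, Finset.sum_smul]
    refine Finset.sum_congr rfl fun n _ => ?_
    rw [Prod.smul_fst, hX.rot_eq n z, smul_smul]
    simp [cplx_Li]
  rw [h]
  simp [cplx_Li]

/-- The rotation part of the Lax bracket is a commutator of two multiples of `L_i`. In particular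
the `w_n` may be read off at any base point, so the polynomial does not depend on `z`. -/
theorem rot_const (hX : IsFiniteTypeSolution (4 * p + 2) X (affineAngle β₀ θ) ξ) (n : ℤ)
    (z z₀ : ℂ) : (ξ n z).1 1 0 = (ξ n z₀).1 1 0 := by
  have hd : ∀ n, Differentiable ℝ fun w => (ξ n w).1 1 0 :=
    fun n => (hX.smooth_rot n 1 0).differentiable (by simp)
  refine is_const_of_fderiv_eq_zero (𝕜 := ℝ) (hd n) (fun x => ?_) z z₀
  ext v
  refine (hX.hasLaurent_fderiv (isLinearMap_rot 1 0) hd x v).eq_zero (fun l hl => ?_) n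
  have h := congrFun (congrFun (congrArg Prod.fst (hX.lax l hl x v)) 1) 0
  refine Eq.trans h ?_
  rw [extendedForm_maurerCartan (hX.Lj_uVec x), bracket, hX.loopEval_rot]
  simp
  ring

theorem fderiv_trans (hX : IsFiniteTypeSolution (4 * p + 2) X (affineAngle β₀ θ) ξ) (n : ℤ)
    (z v : ℂ) (i : Fin 4) :
    fderiv ℝ (fun w => (ξ n w).2 i) z v
      = v * (cplx Li *ᵥ uVec X (affineAngle β₀ θ) z) i * (ξ (n + 1) z).1 1 0
        + starRingEnd ℂ v
          * (cplx Li *ᵥ fun i => starRingEnd ℂ (uVec X (affineAngle β₀ θ) z i)) i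
          * (ξ (n - 1) z).1 1 0
        - (v * (Real.pi * starRingEnd ℂ β₀ / 2) * (cplx Li *ᵥ (ξ (n + 2) z).2) i
          + starRingEnd ℂ v * (Real.pi * β₀ / 2) * (cplx Li *ᵥ (ξ (n - 2) z).2) i) := by
  have hd : ∀ n, Differentiable ℝ fun w => (ξ n w).2 i :=
    fun n => (hX.smooth_trans n i).differentiable (by simp)
  have hLi : IsLinearMap ℂ fun x : GC => (cplx Li *ᵥ x.2) i :=
    ⟨fun x y => by simp [Matrix.mulVec_add], fun a x => by simp [Matrix.mulVec_smul]⟩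
  have hW := hasLaurent_loopEval (hX.loop z).degree (isLinearMap_rot 1 0)
  have hT := hasLaurent_loopEval (hX.loop z).degree hLi
  have h := (hX.hasLaurent_fderiv (isLinearMap_trans i) hd z v).unique
    -- The shifts `-1, 1, -2, 2` are the powers of `λ` carried by `u`, `ū` and the two rotation
    -- terms of `α_λ`.
    ((((hW.const_mul (v * (cplx Li *ᵥ uVec X (affineAngle β₀ θ) z) i)).zpow_mul (-1)).add
      ((hW.const_mul (starRingEnd ℂ v
        * (cplx Li *ᵥ fun i => starRingEnd ℂ (uVec X (affineAngle β₀ θ) z i)) i)).zpow_mul 1)).sub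
      (((hT.const_mul (v * (Real.pi * starRingEnd ℂ β₀ / 2))).zpow_mul (-2)).add
        ((hT.const_mul (starRingEnd ℂ v * (Real.pi * β₀ / 2))).zpow_mul 2))) (fun l hl => ?_) n
  · simpa only [sub_neg_eq_add] using h
  · have h := congrFun (congrArg Prod.snd (hX.lax l hl z v)) i
    rw [extendedForm_maurerCartan (hX.Lj_uVec z), bracket, hX.loopEval_rot] at h
    refine Eq.trans h ?_
    simp only [Matrix.mulVec_add, Matrix.smul_mulVec, Matrix.mulVec_smul, Pi.sub_apply,
      Pi.smul_apply, Pi.add_apply, smul_eq_mul, zpow_one]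
    rw [show l ^ (2 : ℤ) = l ^ 2 from zpow_ofNat l 2]
    ring

theorem dz_trans (hX : IsFiniteTypeSolution (4 * p + 2) X (affineAngle β₀ θ) ξ) (n : ℤ)
    (z z₀ : ℂ) : (fun i => dz (fun w => (ξ n w).2 i) z)
      = (ξ (n + 1) z₀).1 1 0 • (cplx Li *ᵥ uVec X (affineAngle β₀ θ) z)
        - (Real.pi * starRingEnd ℂ β₀ / 2) • (cplx Li *ᵥ (ξ (n + 2) z).2) := by
  ext i
  rw [dz, hX.fderiv_trans, hX.fderiv_trans, hX.rot_const (n + 1) z z₀]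
  simp only [map_one, Complex.conj_I, Pi.sub_apply, Pi.smul_apply, smul_eq_mul]
  ring_nf
  simp only [Complex.I_sq]
  ring

theorem dzbar_uVec (hX : IsFiniteTypeSolution (4 * p + 2) X (affineAngle β₀ θ) ξ) (z : ℂ) :
    (fun i => dzbar (fun w => uVec X (affineAngle β₀ θ) w i) z)
      = (Real.pi * starRingEnd ℂ β₀ / 2)
        • (cplx Li *ᵥ fun i => starRingEnd ℂ (uVec X (affineAngle β₀ θ) z i)) := by
  -- At `n = -d + 1` the term `t_{n-2}` has exponent `-d - 1`, beyond the degree, so the `dz̄` part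
  -- closes up on `u` and `ū`.
  have h0 : (ξ (-(4 * p + 2) + 1 - 2) z).2 = 0 := by
    rw [hX.coeff_eq_zero (by rw [abs_of_neg] <;> omega), Prod.snd_zero]
  ext i
  simp only [hX.uVec_eq]
  rw [dzbar, hX.fderiv_trans, hX.fderiv_trans, h0, add_sub_cancel_right, hX.first_coeff]
  simp only [map_one, Complex.conj_I, Pi.smul_apply, smul_eq_mul, Matrix.mulVec_zero,
    Pi.zero_apply, hX.uVec_eq]
  ring_nf
  simp only [Complex.I_sq]
  ring

theorem contDiff_uVec (hX : IsFiniteTypeSolution (4 * p + 2) X (affineAngle β₀ θ) ξ) (i : Fin 4) :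
    ContDiff ℝ ∞ fun z => uVec X (affineAngle β₀ θ) z i := by
  simp only [hX.uVec_eq]
  exact hX.smooth_trans _ i

theorem dz_conj_uVec (hX : IsFiniteTypeSolution (4 * p + 2) X (affineAngle β₀ θ) ξ) (z : ℂ) :
    (fun i => dz (fun w => starRingEnd ℂ (uVec X (affineAngle β₀ θ) w i)) z)
      = (Real.pi * β₀ / 2) • (cplx Li *ᵥ uVec X (affineAngle β₀ θ) z) := by
  ext i
  rw [dz_conj (hX.contDiff_uVec i), congrFun (hX.dzbar_uVec z) i, cplx_Li]
  fin_cases i <;> simp [dotProduct, Fin.sum_univ_four, Complex.conj_ofNat]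

/-! ### Location of the frequencies -/

variable {b : Module.Basis (Fin 2) ℝ ℂ} {γ : ℂ}

theorem norm_sq_eq (hX : IsFiniteTypeSolution (4 * p + 2) X (affineAngle β₀ θ) ξ)
    (hper : ∀ g ∈ lattice b, ∀ z, X (z + g) = X z)
    (hγ : γ ∈ frequencies b (uVec X (affineAngle β₀ θ))) : ‖γ‖ ^ 2 = ‖β₀ / 2‖ ^ 2 := by
  obtain ⟨hγ2, hne⟩ := hγ
  have hp := doublyPeriodic_uVec hX.immersion hX.angle hper
  have hs := hX.contDiff_uVec
  have hsc : ∀ i, ContDiff ℝ ∞ fun z => starRingEnd ℂ (uVec X (affineAngle β₀ θ) z i) :=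
    fun i => Complex.conjCLE.contDiff.comp (hs i)
  have h1 := fourierCoefficient_dzbar hγ2 hs hp
  have h2 := fourierCoefficient_dz (u := fun z i => starRingEnd ℂ (uVec X (affineAngle β₀ θ) z i))
    hγ2 hsc (fun i j z => congrArg (starRingEnd ℂ) (hp i j z))
  rw [show (fun z i => dzbar (fun w => uVec X (affineAngle β₀ θ) w i) z) = _ from
    funext hX.dzbar_uVec, fourierCoefficient_const_smul,
    fourierCoefficient_mulVec _ fun i => (hsc i).continuous] at h1
  rw [show (fun z i => dz (fun w => starRingEnd ℂ (uVec X (affineAngle β₀ θ) w i)) z) = _ from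
    funext hX.dz_conj_uVec, fourierCoefficient_const_smul,
    fourierCoefficient_mulVec _ fun i => (hs i).continuous] at h2
  change _ = (Complex.I * Real.pi * γ) • fourierCoefficient b (uVec X (affineAngle β₀ θ)) γ at h1
  generalize fourierCoefficient b (uVec X (affineAngle β₀ θ)) γ = U at h1 h2 hne
  generalize fourierCoefficient b
    (fun z i => starRingEnd ℂ (uVec X (affineAngle β₀ θ) z i)) γ = V at h1 h2
  -- Eliminating the coefficient `V` of `ū` between the two equations, with `L_i² = -1`, leaves a
  -- scalar acting on `U`.
  have h3 : ((Complex.I * Real.pi * starRingEnd ℂ γ) * (Complex.I * Real.pi * γ)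
      + (Real.pi * starRingEnd ℂ β₀ / 2) * (Real.pi * β₀ / 2)) • U = 0 := by
    rw [add_smul, mul_smul, ← h1, smul_comm, ← Matrix.mulVec_smul, ← h2, Matrix.mulVec_smul,
      Li_mulVec_Li_mulVec, mul_smul, smul_neg, smul_neg, neg_add_cancel]
  have h4 := (smul_eq_zero.1 h3).resolve_right hne
  have hpi : (Real.pi : ℂ) ^ 2 ≠ 0 := by
    exact_mod_cast pow_ne_zero 2 Real.pi_ne_zero
  have h5 : γ * starRingEnd ℂ γ = β₀ / 2 * starRingEnd ℂ (β₀ / 2) := by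
    refine mul_left_cancel₀ hpi ?_
    rw [map_div₀, map_ofNat]
    linear_combination (Real.pi : ℂ) ^ 2 * γ * starRingEnd ℂ γ * Complex.I_sq - h4
  rw [Complex.mul_conj, Complex.mul_conj, Complex.normSq_eq_norm_sq, Complex.normSq_eq_norm_sq]
    at h5
  exact_mod_cast h5

theorem contDiff_ofReal_comp (hX : IsConformalLagrangianImmersion X) (i : Fin 4) :
    ContDiff ℝ ∞ fun w => (X w i : ℂ) :=
  Complex.ofRealCLM.contDiff.comp (contDiff_pi.1 hX.smooth i)

theorem fourierCoefficient_eq_zero_of_eq_half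
    (hX : IsFiniteTypeSolution (4 * p + 2) X (affineAngle β₀ θ) ξ)
    (hper : ∀ g ∈ lattice b, ∀ z, X (z + g) = X z) {ε : ℂ} (hε : ε ^ 2 = 1)
    (hγ : γ = ε * (β₀ / 2)) : fourierCoefficient b (uVec X (affineAngle β₀ θ)) γ = 0 := by
  have hs := fun i => (hX.contDiff_uVec i).continuous
  have hX' := contDiff_ofReal_comp hX.immersion
  have hXc := fun i => (hX' i).continuous_fderiv (by simp : (∞ : WithTop ℕ∞) ≠ 0)
  have hDc : ∀ i, Continuous fun z => dz (fun w => (X w i : ℂ)) z := fun i => by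
    have := hXc i
    unfold dz
    fun_prop
  have hXp : ∀ i, DoublyPeriodic b fun w => (X w i : ℂ) := fun i j z => by
    have hg := hper (2 • b j) (Submodule.smul_mem _ _ (Submodule.subset_span ⟨j, rfl⟩)) z
    rw [two_smul, ← two_mul] at hg
    beta_reduce
    rw [hg]
  have hDm : ∀ i, torusMean b (fun z => dz (fun w => (X w i : ℂ)) z) = 0 := fun i => by
    have hi := hXc i
    have h1 := fun v => torusMean_fderiv ((hX' i).of_le (by exact_mod_cast le_top)) (hXp i) v
    have h2 : (fun z => dz (fun w => (X w i : ℂ)) z) = fun z =>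
        1 / 2 * fderiv ℝ (fun w => (X w i : ℂ)) z 1
          + -(Complex.I / 2) * fderiv ℝ (fun w => (X w i : ℂ)) z Complex.I := by
      ext z; rw [dz]; ring
    rw [h2, torusMean_add (by fun_prop) (by fun_prop), torusMean_const_mul, torusMean_const_mul,
      h1, h1, mul_zero, mul_zero, add_zero]
  have hLi : fourierCoefficient b (fun z => cplx Li *ᵥ uVec X (affineAngle β₀ θ) z) γ
      = cplx Li *ᵥ fourierCoefficient b (uVec X (affineAngle β₀ θ)) γ :=
    fourierCoefficient_mulVec _ hs
  have hLj : cplx Lj *ᵥ fourierCoefficient b (uVec X (affineAngle β₀ θ)) γ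
      = Complex.I • fourierCoefficient b (uVec X (affineAngle β₀ θ)) γ := by
    rw [← fourierCoefficient_const_smul, ← fourierCoefficient_mulVec _ hs]
    simp only [hX.Lj_uVec]
  have hLic : ∀ i, Continuous fun z => (cplx Li *ᵥ uVec X (affineAngle β₀ θ) z) i := fun i => by
    simp only [Matrix.mulVec, dotProduct]
    fun_prop
  have hsum : fourierCoefficient b (uVec X (affineAngle β₀ θ)) γ
      + (ε * Complex.I) • (cplx Li *ᵥ fourierCoefficient b (uVec X (affineAngle β₀ θ)) γ) = 0 := by
    rw [← hLi, ← fourierCoefficient_const_smul, ← fourierCoefficient_add hs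
      (fun i => by simp only [Pi.smul_apply, smul_eq_mul]; have := hLic i; fun_prop)]
    -- At this frequency the conjugate wave cancels the phase of the spinor exactly, leaving the
    -- mean of derivatives of `X`.
    have hw : ∀ z, wave γ z * Complex.exp (ε * Complex.I * (affineAngle β₀ θ z / 2))
        = Complex.exp (ε * Complex.I * (θ / 2)) := by
      intro z
      have hin : ((inner ℝ γ z : ℝ) : ℂ) = ε * ((inner ℝ β₀ z : ℝ) : ℂ) / 2 := by
        rcases sq_eq_sq_iff_eq_or_eq_neg.1 (hε.trans (one_pow 2).symm) with rfl | rfl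
        · rw [hγ, show 1 * (β₀ / 2) = (1 / 2 : ℝ) • β₀ by
            rw [Complex.real_smul]; push_cast; ring, real_inner_smul_left]
          push_cast; ring
        · rw [hγ, show -1 * (β₀ / 2) = (-1 / 2 : ℝ) • β₀ by
            rw [Complex.real_smul]; push_cast; ring, real_inner_smul_left]
          push_cast; ring
      rw [wave, ← Complex.exp_add, hin, affineAngle]
      congr 1
      push_cast; ring
    simp only [uVec_add_I_smul hX.immersion hε]
    ext i
    have h2 : ∀ z, wave γ z * (Complex.exp (ε * Complex.I * (affineAngle β₀ θ z / 2))
        • ((fun i => dz (fun w => (X w i : ℂ)) z)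
          + (ε * Complex.I) • (cplx Li *ᵥ fun i => dz (fun w => (X w i : ℂ)) z))) i
        = Complex.exp (ε * Complex.I * (θ / 2)) * (dz (fun w => (X w i : ℂ)) z
          + (ε * Complex.I) * (cplx Li *ᵥ fun i => dz (fun w => (X w i : ℂ)) z) i) := by
      intro z
      rw [Pi.smul_apply, smul_eq_mul, ← mul_assoc, hw]
      rfl
    have hLD : torusMean b (fun z => (cplx Li *ᵥ fun i => dz (fun w => (X w i : ℂ)) z) i) = 0 := by
      simp only [Matrix.mulVec, dotProduct, Fin.sum_univ_four]
      rw [torusMean_add (by fun_prop) (by fun_prop), torusMean_add (by fun_prop) (by fun_prop),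
        torusMean_add (by fun_prop) (by fun_prop)]
      simp only [torusMean_const_mul, hDm, mul_zero, add_zero]
    have hLDc : Continuous (fun z => (cplx Li *ᵥ fun i => dz (fun w => (X w i : ℂ)) z) i) := by
      simp only [Matrix.mulVec, dotProduct]
      fun_prop
    rw [fourierCoefficient_apply, scalarCoeff]
    simp only [h2]
    rw [torusMean_const_mul, torusMean_add (hDc i) (by fun_prop), torusMean_const_mul, hDm, hLD]
    simp
  generalize fourierCoefficient b (uVec X (affineAngle β₀ θ)) γ = U at hLj hsum
  have hε0 : ε ≠ 0 := by rintro rfl; simp at hε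
  have h1 : cplx Li *ᵥ U = (ε * Complex.I) • U := by
    have h := congrArg (fun V => cplx Li *ᵥ V) hsum
    simp only [Matrix.mulVec_add, Matrix.mulVec_smul, Li_mulVec_Li_mulVec, Matrix.mulVec_zero,
      smul_neg] at h
    exact add_neg_eq_zero.1 h
  -- `U` is now an eigenvector of both `L_i` and `L_j` with nonzero eigenvalues; anticommutation
  -- leaves only `U = 0`.
  have h2 := Lj_mulVec_Li_mulVec U
  rw [h1, hLj, Matrix.mulVec_smul, Matrix.mulVec_smul, hLj, h1, smul_smul, smul_smul,
    ← neg_smul, ← sub_eq_zero, ← sub_smul] at h2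
  refine (smul_eq_zero.1 h2).resolve_left fun h => hε0 ?_
  linear_combination (-1 / 2) * h + ε * Complex.I_sq

theorem frequencies_subset (hX : IsFiniteTypeSolution (4 * p + 2) X (affineAngle β₀ θ) ξ)
    (hper : ∀ g ∈ lattice b, ∀ z, X (z + g) = X z) :
    frequencies b (uVec X (affineAngle β₀ θ)) ⊆ dualCircle b β₀ := by
  intro γ hγ
  refine ⟨sub_mem_dualLattice_of_fourierCoefficient_ne_zero hX.immersion hX.angle hper hγ,
    hX.norm_sq_eq hper hγ, fun h => hγ.2 ?_⟩
  rcases sq_eq_sq_iff_eq_or_eq_neg.1 h with h | h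
  · exact hX.fourierCoefficient_eq_zero_of_eq_half hper (one_pow 2) (by rw [h, one_mul])
  · exact hX.fourierCoefficient_eq_zero_of_eq_half hper (ε := -1) (by norm_num) (by rw [h]; ring)

/-! ### The polynomial equation -/

/-- For `β₀ = 0` the circle is empty: `|γ| = 0` contradicts `γ² ≠ 0`. This legitimises the divisions
by `β₀` below. -/
theorem ne_zero_of_mem_frequencies
    (hX : IsFiniteTypeSolution (4 * p + 2) X (affineAngle β₀ θ) ξ)
    (hper : ∀ g ∈ lattice b, ∀ z, X (z + g) = X z)
    (hγ : γ ∈ frequencies b (uVec X (affineAngle β₀ θ))) : β₀ ≠ 0 := by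
  rintro rfl
  obtain ⟨_, h1, h2⟩ := hX.frequencies_subset hper hγ
  simp at h1
  simp [h1] at h2

/-- Applying `L_i` to the `dz` part of the Lax equation and using `L_i² = -1` isolates the highest
coefficient. -/
theorem trans_add_two (hX : IsFiniteTypeSolution (4 * p + 2) X (affineAngle β₀ θ) ξ)
    (hβ : β₀ ≠ 0) (n : ℤ) (z z₀ : ℂ) :
    (ξ (n + 2) z).2 = (2 / (Real.pi * starRingEnd ℂ β₀)) •
      ((ξ (n + 1) z₀).1 1 0 • uVec X (affineAngle β₀ θ) z
        + cplx Li *ᵥ fun i => dz (fun w => (ξ n w).2 i) z) := by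
  have hβ' : starRingEnd ℂ β₀ ≠ 0 := by simpa using hβ
  have hpi : (Real.pi : ℂ) ≠ 0 := by exact_mod_cast Real.pi_ne_zero
  rw [hX.dz_trans n z z₀]
  simp only [Matrix.mulVec_sub, Matrix.mulVec_smul, Li_mulVec_Li_mulVec]
  ext i
  simp
  field_simp

theorem doublyPeriodic_trans (hX : IsFiniteTypeSolution (4 * p + 2) X (affineAngle β₀ θ) ξ)
    (hper : ∀ g ∈ lattice b, ∀ z, X (z + g) = X z) (hβ : β₀ ≠ 0) (k : ℕ) (i : Fin 4) :
    DoublyPeriodic b fun z => (ξ (-(4 * p + 2) + 1 + 2 * k) z).2 i := by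
  have hu := doublyPeriodic_uVec hX.immersion hX.angle hper
  induction k generalizing i with
  | zero => simpa [hX.uVec_eq] using hu i
  | succ k ih =>
    intro j z
    have h1 : ∀ z, uVec X (affineAngle β₀ θ) (z + 2 * b j) = uVec X (affineAngle β₀ θ) z :=
      fun z => funext fun i => hu i j z
    have h2 := fun i => doublyPeriodic_dz (ih i) j z
    have e : (-(4 * p + 2) + 1 + 2 * ((k + 1 : ℕ) : ℤ) : ℤ)
      = (-(4 * p + 2) + 1 + 2 * k) + 2 := by push_cast; ring
    simp only [e, hX.trans_add_two hβ _ _ 0, h1, h2]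

theorem potentialCoeff_eq (hX : IsFiniteTypeSolution (4 * p + 2) X (affineAngle β₀ θ) ξ)
    (q : ℤ) (z₀ : ℂ) : potentialCoeff β₀ (fun n => ξ n z₀) q
      = 2 / (Real.pi * starRingEnd ℂ β₀) * (ξ (4 * q + 2) z₀).1 1 0 := by
  rw [potentialCoeff]
  congr 1
  have h : ξ (4 * q + 2) z₀ = ((ξ (4 * q + 2) z₀).1 1 0 • cplx Li, (ξ (4 * q + 2) z₀).2) :=
    Prod.ext (hX.rot_eq _ z₀) rfl
  rw [h, liCoeff_smul]
  simp [cplx_Li]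

theorem fourierCoefficient_trans_add_two
    (hX : IsFiniteTypeSolution (4 * p + 2) X (affineAngle β₀ θ) ξ)
    (hper : ∀ g ∈ lattice b, ∀ z, X (z + g) = X z) (hβ : β₀ ≠ 0) (hγ : 2 * γ ∈ dualLattice b)
    (k : ℕ) (z₀ : ℂ) {n : ℤ} (hn : n = -(4 * p + 2) + 1 + 2 * k) :
    fourierCoefficient b (fun z => (ξ (n + 2) z).2) γ = (2 / (Real.pi * starRingEnd ℂ β₀)) •
      ((ξ (n + 1) z₀).1 1 0 • fourierCoefficient b (uVec X (affineAngle β₀ θ)) γ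
        + (Complex.I * Real.pi * starRingEnd ℂ γ)
          • (cplx Li *ᵥ fourierCoefficient b (fun z => (ξ n z).2) γ)) := by
  have hs := fun i => (hX.contDiff_uVec i).continuous
  have hp := hX.doublyPeriodic_trans hper hβ k
  rw [← hn] at hp
  have hDc : ∀ i, Continuous fun z => dz (fun w => (ξ n w).2 i) z := fun i => by
    have := (hX.smooth_trans n i).continuous_fderiv (by simp : (∞ : WithTop ℕ∞) ≠ 0)
    unfold dz
    fun_prop
  rw [funext fun z => hX.trans_add_two hβ n z z₀, fourierCoefficient_const_smul,
    fourierCoefficient_add, fourierCoefficient_const_smul, fourierCoefficient_mulVec _ hDc,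
    fourierCoefficient_dz (u := fun z => (ξ n z).2) hγ (hX.smooth_trans n) hp, Matrix.mulVec_smul]
  · intro i
    have := hs i
    simp only [Pi.smul_apply, smul_eq_mul]
    fun_prop
  · intro i
    simp only [Matrix.mulVec, dotProduct]
    fun_prop

theorem pow_smul_fourierCoefficient
    (hX : IsFiniteTypeSolution (4 * p + 2) X (affineAngle β₀ θ) ξ)
    (hper : ∀ g ∈ lattice b, ∀ z, X (z + g) = X z)
    (hγ : γ ∈ frequencies b (uVec X (affineAngle β₀ θ))) (z₀ : ℂ) (m : ℕ) :
    ((2 * γ / β₀) ^ (2 * m))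
        • fourierCoefficient b (fun z => (ξ (-(4 * p + 2) + 1 + 4 * m) z).2) γ
      = (∑ q ∈ Finset.range (m + 1), potentialCoeff β₀ (fun n => ξ n z₀) ((q : ℤ) - p - 1)
          * (2 * γ / β₀) ^ (2 * q)) • fourierCoefficient b (uVec X (affineAngle β₀ θ)) γ := by
  have hβ := hX.ne_zero_of_mem_frequencies hper hγ
  have hβ' : starRingEnd ℂ β₀ ≠ 0 := by simpa using hβ
  have hpi : (Real.pi : ℂ) ≠ 0 := by exact_mod_cast Real.pi_ne_zero
  have hnorm : γ * starRingEnd ℂ γ = β₀ * starRingEnd ℂ β₀ / 4 := by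
    have h := hX.norm_sq_eq hper hγ
    rw [Complex.mul_conj, Complex.mul_conj, Complex.normSq_eq_norm_sq,
      Complex.normSq_eq_norm_sq, h, norm_div]
    push_cast
    norm_num
    ring
  induction m with
  | zero =>
    have h0 : (4 * ((0 : ℕ) - p - 1 : ℤ) + 2) = -(4 * p + 2) := by push_cast; ring
    -- The normalisation of `c_q` makes the first one equal to `1`, since `w_{-d} = πβ̄₀/2`.
    have h1 : potentialCoeff β₀ (fun n => ξ n z₀) (((0 : ℕ) : ℤ) - p - 1) = 1 := by
      rw [hX.potentialCoeff_eq, h0, hX.first_coeff]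
      field_simp
    simp only [Finset.sum_range_succ, Finset.sum_range_zero, h1]
    simp only [mul_zero, pow_zero, Nat.cast_zero, add_zero, zero_add, mul_one, ← hX.uVec_eq]
  | succ m ih =>
    have e1 := hX.fourierCoefficient_trans_add_two hper hβ hγ.1 (2 * m) z₀
      (n := -(4 * p + 2) + 1 + 4 * m) (by push_cast; ring)
    have e2 := hX.fourierCoefficient_trans_add_two hper hβ hγ.1 (2 * m + 1) z₀
      (n := -(4 * p + 2) + 1 + 4 * m + 2) (by push_cast; ring)
    -- The intermediate rotation coefficient has exponent `4(m - p)`, so only every second step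
    -- contributes a `c_q`.
    rw [hX.normalized (-(4 * p + 2) + 1 + 4 * m + 1) ⟨m - p, by ring⟩] at e1
    rw [show (-(4 * p + 2) + 1 + 4 * m + 2 + 1 : ℤ) = 4 * (((m + 1 : ℕ) : ℤ) - p - 1) + 2 by
      push_cast; ring, show (-(4 * p + 2) + 1 + 4 * m + 2 + 2 : ℤ)
      = -(4 * p + 2) + 1 + 4 * ((m + 1 : ℕ) : ℤ) by push_cast; ring, e1] at e2
    rw [Finset.sum_range_succ, add_smul, ← ih, e2, hX.potentialCoeff_eq]
    simp only [Prod.fst_zero, Matrix.zero_apply, zero_smul, zero_add, Matrix.mulVec_smul,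
      Li_mulVec_Li_mulVec]
    generalize fourierCoefficient b (fun z => (ξ (-(4 * p + 2) + 1 + 4 * m) z).2) γ = S
    generalize fourierCoefficient b (uVec X (affineAngle β₀ θ)) γ = U
    -- The two factors are `(2γ/β₀)²` and `(2γ̄/β̄₀)²`, inverse to each other because `|γ| =
    -- |β₀/2|`.
    have hρ : (2 * γ / β₀) ^ 2 * (2 / (Real.pi * starRingEnd ℂ β₀) * (Real.pi * starRingEnd ℂ γ)) ^ 2
        = 1 := by
      rw [← mul_pow, show 2 * γ / β₀ * (2 / (Real.pi * starRingEnd ℂ β₀)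
        * (Real.pi * starRingEnd ℂ γ)) = 4 / (β₀ * starRingEnd ℂ β₀) * (γ * starRingEnd ℂ γ) by
          field_simp; ring, hnorm]
      field_simp
    ext i
    simp only [Pi.add_apply, Pi.smul_apply, Pi.neg_apply, smul_eq_mul]
    generalize 2 / (Real.pi * starRingEnd ℂ β₀) = r at hρ ⊢
    rw [show 2 * (m + 1) = 2 * m + 2 by ring, pow_add]
    linear_combination (2 * γ / β₀) ^ (2 * m) * S i * hρ
      - (2 * γ / β₀) ^ (2 * m) * S i * (2 * γ / β₀) ^ 2 * r ^ 2 * (Real.pi * starRingEnd ℂ γ) ^ 2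
        * Complex.I_sq

theorem eval_frequencyPolynomial
    (hX : IsFiniteTypeSolution (4 * p + 2) X (affineAngle β₀ θ) ξ)
    (hper : ∀ g ∈ lattice b, ∀ z, X (z + g) = X z)
    (hγ : γ ∈ frequencies b (uVec X (affineAngle β₀ θ))) (z₀ : ℂ) :
    (frequencyPolynomial p β₀ (fun n => ξ n z₀)).eval γ = 0 := by
  have hβ := hX.ne_zero_of_mem_frequencies hper hγ
  have hβ' : starRingEnd ℂ β₀ ≠ 0 := by simpa using hβ
  have hpi : (Real.pi : ℂ) ≠ 0 := by exact_mod_cast Real.pi_ne_zero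
  have h := hX.pow_smul_fourierCoefficient hper hγ z₀ (2 * p + 1)
  -- The exponent is `d + 1`, the first one past the degree.
  have h0 : ∀ z, (ξ (-(4 * p + 2) + 1 + 4 * ((2 * p + 1 : ℕ) : ℤ)) z).2 = 0 := fun z => by
    rw [hX.coeff_eq_zero (by rw [abs_of_pos] <;> push_cast <;> omega), Prod.snd_zero]
  have h1 : fourierCoefficient b (fun z => (0 : Fin 4 → ℂ)) γ = 0 := by
    simpa using fourierCoefficient_const_smul (b := b) (γ := γ) 0 (fun _ => (0 : Fin 4 → ℂ))
  simp only [h0, h1, smul_zero] at h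
  have h2 := (smul_eq_zero.1 h.symm).resolve_right hγ.2
  -- The top term has `c_p = β₀/β̄₀`; it becomes the leading monomial after multiplication by
  -- `(β̄₀/2)(β₀/2)^{4p+1}`.
  rw [Finset.sum_range_succ, hX.potentialCoeff_eq, show
    4 * (((2 * p + 1 : ℕ) : ℤ) - p - 1) + 2 = 4 * p + 2 by push_cast; ring, hX.last_coeff] at h2
  rw [frequencyPolynomial]
  simp only [Polynomial.eval_add, Polynomial.eval_mul, Polynomial.eval_pow, Polynomial.eval_X,
    Polynomial.eval_C, Polynomial.eval_finsetSum]
  simp only [div_mul_eq_mul_div]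
  rw [eq_neg_of_add_eq_zero_left h2]
  have h3 : (2 * γ / β₀) ^ (2 * (2 * p + 1)) = γ ^ (4 * p + 2) / (β₀ / 2) ^ (4 * p + 2) := by
    rw [← div_pow, show 2 * (2 * p + 1) = 4 * p + 2 by ring]
    congr 1
    field_simp
  rw [h3, pow_succ (β₀ / 2) (4 * p + 1)]
  have h4 : (β₀ / 2) ^ (4 * p + 1) ≠ 0 := pow_ne_zero _ (div_ne_zero hβ two_ne_zero)
  generalize (β₀ / 2) ^ (4 * p + 1) = w at h4
  field_simp
  ring

end IsFiniteTypeSolution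

/-! ### Degree of the polynomial and the root count -/

/-- The sum stops at exponent `4p`, so the leading monomial survives whatever the coefficients are,
including for `β₀ = 0`, where `2 / β₀` is `0` by convention. -/
theorem natDegree_frequencyPolynomial (p : ℕ) (β₀ : ℂ) (η : ℤ → GC) :
    (frequencyPolynomial p β₀ η).natDegree = 4 * p + 2 := by
  rw [frequencyPolynomial, Polynomial.natDegree_add_eq_left_of_natDegree_lt,
    Polynomial.natDegree_X_pow]
  rw [Polynomial.natDegree_X_pow]
  refine lt_of_le_of_lt ((Polynomial.natDegree_C_mul_le _ _).trans
    (Polynomial.natDegree_sum_le_of_forall_le (n := 4 * p) _ _ fun q hq => ?_)) (by omega)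
  refine (Polynomial.natDegree_C_mul_le _ _).trans ?_
  refine Polynomial.natDegree_pow_le.trans ?_
  have h1 := Polynomial.natDegree_C_mul_le (2 / β₀) (Polynomial.X : Polynomial ℂ)
  rw [Polynomial.natDegree_X] at h1
  have h2 := Finset.mem_range.1 hq
  calc 2 * q * _ ≤ 2 * q * 1 := Nat.mul_le_mul_left _ h1
    _ ≤ 4 * p := by omega

end HSL

end

theorem mainTheorem9 (b : Module.Basis (Fin 2) ℝ ℂ) (p : ℕ) (β₀ : ℂ) (θ : ℝ)
    (X : ℂ → Fin 4 → ℝ) (ξ : ℤ → ℂ → HSL.GC) (z₀ : ℂ)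
    (hper : ∀ g ∈ HSL.lattice b, ∀ z, X (z + g) = X z)
    (hX : HSL.IsFiniteTypeSolution (4 * p + 2) X (HSL.affineAngle β₀ θ) ξ) :
    HSL.frequencies b (HSL.uVec X (HSL.affineAngle β₀ θ)) ⊆ HSL.dualCircle b β₀ ∧
    (HSL.frequencyPolynomial p β₀ (fun n => ξ n z₀)).natDegree = 4 * p + 2 ∧
    (∀ γ ∈ HSL.frequencies b (HSL.uVec X (HSL.affineAngle β₀ θ)),
      (HSL.frequencyPolynomial p β₀ (fun n => ξ n z₀)).eval γ = 0) ∧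
    (HSL.frequencies b (HSL.uVec X (HSL.affineAngle β₀ θ))).encard ≤ ((4 * p + 2 : ℕ) : ℕ∞) ∧
    (HSL.dualCircle b β₀ ⊆ HSL.frequencies b (HSL.uVec X (HSL.affineAngle β₀ θ)) →
      (HSL.dualCircle b β₀).encard ≤ ((4 * p + 2 : ℕ) : ℕ∞)) := by
  have hdeg := HSL.natDegree_frequencyPolynomial p β₀ (fun n => ξ n z₀)
  have hroot : ∀ γ ∈ HSL.frequencies b (HSL.uVec X (HSL.affineAngle β₀ θ)),
      (HSL.frequencyPolynomial p β₀ (fun n => ξ n z₀)).eval γ = 0 :=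
    fun γ hγ => hX.eval_frequencyPolynomial hper hγ z₀
  have hcard : (HSL.frequencies b (HSL.uVec X (HSL.affineAngle β₀ θ))).encard
      ≤ ((4 * p + 2 : ℕ) : ℕ∞) := by
    set P := HSL.frequencyPolynomial p β₀ (fun n => ξ n z₀) with hP
    have hP0 : P ≠ 0 := by
      intro h
      rw [h, Polynomial.natDegree_zero] at hdeg
      omega
    refine (Set.encard_le_encard (t := P.roots.toFinset) fun γ hγ => ?_).trans ?_
    · simpa [hP0] using hroot γ hγ
    · rw [Set.encard_coe_eq_coe_finsetCard, Nat.cast_le, ← hdeg]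
      exact (Multiset.toFinset_card_le _).trans (Polynomial.card_roots' P)
  exact ⟨hX.frequencies_subset hper, hdeg, hroot, hcard,
    fun h => (Set.encard_le_encard h).trans hcard⟩
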